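/- Let $r \le m \le n$ be nonnegative integers ($r$ is the target rank), let $A \in \mathbb{R}^{m\times n}$ and let $\Gamma \in \mathbb{R}^{n\times n}$ be symmetric positive definite. Put $H = A^\top A$, with eigenvalues $\lambda_1 \ge \lambda_2 \ge \dots \ge \lambda_n \ge 0$, and let $\mathcal{H} = \Gamma^{-1/2}(I+H)\Gamma^{-1/2}$ be the Gauss–Newton Hessian. Write $\|x\|_{\Gamma^{-1}} = \|\Gamma^{-1/2}x\|_2$ and $\kappa_2(M) = \|M\|_2\,\|M^{-1}\|_2$, where $\|M\|_2$ is the spectral norm. Set $\ell_1 = 2r+1$, $\ell_2 = 2\ell_1+1 = 4r+3$, and let $\Omega \in \mathbb{R}^{n\times \ell_1}$, $\Psi\in\mathbb{R}^{m\times \ell_2}$ be independent standard Gaussian random matrices (all entries of both are independent and $N(0,1)$). The SingleView sketch is computed as follows. Form $Y = A\Omega$ and $Z = A^\top \Psi$; compute a thin QR factorization $Y = Q_Y R_Y$, by a fixed routine for which $Q_Y$ is a measurable function of $Y$; compute a thin QR factorization $M := \Psi^\top Q_Y = Q_M R_M$; form $W = R_M^\dagger (Z Q_M)^\top$ ($\dagger$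 denotes the Moore–Penrose inverse) and a thin SVD $W = \widehat U \widehat\Sigma \widehat V^\top$; return $\widehat V$ and $\widehat\Lambda = \widehat\Sigma^2$. (A thin factorization of a $p\times q$ matrix has $\min(p,q)$ orthonormal columns in its orthogonal factors.) Let $\widehat H = \widehat V \widehat \Lambda \widehat V^\top$ and $\widehat{\mathcal H} = \Gamma^{-1/2}(I+\widehat H)\Gamma^{-1/2}$, and define $$\Theta_H = 3\Big(\sum_{j>r}\lambda_1\lambda_j\Big)^{1/2} + \frac94 \sum_{j>r}\lambda_j .$$ Then: 1. For every fixed nonzero $g\in\mathbb{R}^n$, let $\delta x$ and $\delta\widehat x$ be the solutions of $\mathcal H\,\delta x = -g$ and $\widehat{\mathcal H}\,\delta\widehat x = -g$. The relative error of the step is integrable and $$\mathbb{E}\left[\frac{\|\delta x - \delta \widehat x\|_{\Gamma^{-1}}}{\|\delta x\|_{\Gamma^{-1}}}\right] \le \Theta_H .$$ 2. The square root of the condition number of the preconditioned operator is integrable and $$\mathbb{E}\left[\sqrt{\kappa_2\big((I+\widehat H)^{-1/2}(I+H)(I+\widehat H)^{-1/2}\big)}\right] \le 1+\Theta_H .$$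 Moreover, if $\lambda_{r+1}\ne 0$ (where $\lambda_{n+1} := 0$), then with the intrinsic dimension $\mathrm{id}_r = \big(\sum_{j>r}\lambda_j\big)/\lambda_{r+1}$, $$\Theta_H = \left(3\Big(\frac{\lambda_1}{\lambda_{r+1}}\Big)^{1/2}\mathrm{id}_r^{1/2} + \frac94\,\mathrm{id}_r\right)\lambda_{r+1}.$$ -/

import Mathlib

open MeasureTheory ProbabilityTheory
open scoped Matrix

noncomputable section

namespace GNSketch

/-! Linear algebra -/

/-- The square root `M^{1/2}` of a (symmetric positive semidefinite) real matrix. -/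
def msqrt {n : ℕ} (M : Matrix (Fin n) (Fin n) ℝ) : Matrix (Fin n) (Fin n) ℝ :=
  open scoped MatrixOrder in CFC.sqrt M

/-- The Euclidean norm of a real vector. -/
def norm2 {n : ℕ} (x : Fin n → ℝ) : ℝ :=
  ‖(WithLp.toLp 2 x : EuclideanSpace ℝ (Fin n))‖

/-- The weighted norm `‖x‖_M = ‖M^{1/2} x‖₂`. -/
def weightedNorm {n : ℕ} (M : Matrix (Fin n) (Fin n) ℝ) (x : Fin n → ℝ) : ℝ :=
  norm2 (msqrt M *ᵥ x)

/-- The 2-norm condition number for inversion, `κ₂(M) = ‖M‖₂ ‖M⁻¹‖₂` (spectral norms). -/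
def cond2 {n : ℕ} (M : Matrix (Fin n) (Fin n) ℝ) : ℝ :=
  open scoped Matrix.Norms.L2Operator in ‖M‖ * ‖M⁻¹‖

/-- `Y = Q R` is a thin QR factorization: `Q` has `min p q` orthonormal columns and `R` is
upper triangular (trapezoidal if `p < q`). -/
def IsThinQR {p q : ℕ} (Y : Matrix (Fin p) (Fin q) ℝ)
    (Q : Matrix (Fin p) (Fin (min p q)) ℝ) (R : Matrix (Fin (min p q)) (Fin q) ℝ) : Prop :=
  Y = Q * R ∧ Qᵀ * Q = 1 ∧ ∀ (i : Fin (min p q)) (j : Fin q), (j : ℕ) < (i : ℕ) → R i j = 0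

/-- `W = U diag(s) Vᵀ` is a thin singular value decomposition: `U` and `V` have `min p q`
orthonormal columns, and the singular values `s` are nonnegative and nonincreasing. -/
def IsThinSVD {p q : ℕ} (W : Matrix (Fin p) (Fin q) ℝ)
    (U : Matrix (Fin p) (Fin (min p q)) ℝ) (s : Fin (min p q) → ℝ)
    (V : Matrix (Fin q) (Fin (min p q)) ℝ) : Prop :=
  W = U * Matrix.diagonal s * Vᵀ ∧ Uᵀ * U = 1 ∧ Vᵀ * V = 1 ∧ (∀ i, 0 ≤ s i) ∧ Antitone s

/-- `X` is the Moore–Penrose inverse of `B`. -/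
def IsMoorePenroseInverse {p q : ℕ} (B : Matrix (Fin p) (Fin q) ℝ)
    (X : Matrix (Fin q) (Fin p) ℝ) : Prop :=
  B * X * B = B ∧ X * B * X = X ∧ (B * X)ᵀ = B * X ∧ (X * B)ᵀ = X * B

/-! The SingleView algorithm -/

/-- `qr` is a thin QR routine on `p × q` matrices: it returns a thin QR factorization `(Q, R)` of
every input `Y`, and the entries of the factor `Q` are Borel functions of the entries of `Y`. -/
def IsThinQRRoutine {p q : ℕ}
    (qr : Matrix (Fin p) (Fin q) ℝ →
      Matrix (Fin p) (Fin (min p q)) ℝ × Matrix (Fin (min p q)) (Fin q) ℝ) : Prop :=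
  (∀ Y, IsThinQR Y (qr Y).1 (qr Y).2) ∧
  ∀ i j, Measurable fun Y : Fin p → Fin q → ℝ => (qr (Matrix.of Y)).1 i j

/-- `(V, L)` is an output of the SingleView algorithm on the operator `A` with test matrices
`Om`, `Ps`, where the sketch `Y = A Om` is factorized by the QR routine `qr`:
with `Y = A Om`, `Z = Aᵀ Ps`, `Y = Q_Y R_Y`, `M = Psᵀ Q_Y = Q_M R_M`, `W = R_M† (Z Q_M)ᵀ` and a
thin SVD `W = U S Vᵀ`, one has `L = S²`. -/
def IsSingleViewOutput {m n l₁ l₂ : ℕ} (A : Matrix (Fin m) (Fin n) ℝ)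
    (qr : Matrix (Fin m) (Fin l₁) ℝ →
      Matrix (Fin m) (Fin (min m l₁)) ℝ × Matrix (Fin (min m l₁)) (Fin l₁) ℝ)
    (Om : Matrix (Fin n) (Fin l₁) ℝ) (Ps : Matrix (Fin m) (Fin l₂) ℝ)
    (V : Matrix (Fin n) (Fin (min (min m l₁) n)) ℝ)
    (L : Matrix (Fin (min (min m l₁) n)) (Fin (min (min m l₁) n)) ℝ) : Prop :=
  let Y : Matrix (Fin m) (Fin l₁) ℝ := A * Om
  let Z : Matrix (Fin n) (Fin l₂) ℝ := Aᵀ * Ps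
  let QY : Matrix (Fin m) (Fin (min m l₁)) ℝ := (qr Y).1
  ∃ (QM : Matrix (Fin l₂) (Fin (min l₂ (min m l₁))) ℝ)
    (RM : Matrix (Fin (min l₂ (min m l₁))) (Fin (min m l₁)) ℝ)
    (RMpinv : Matrix (Fin (min m l₁)) (Fin (min l₂ (min m l₁))) ℝ)
    (U : Matrix (Fin (min m l₁)) (Fin (min (min m l₁) n)) ℝ)
    (s : Fin (min (min m l₁) n) → ℝ),
    IsThinQR (Psᵀ * QY) QM RM ∧
    IsMoorePenroseInverse RM RMpinv ∧
    IsThinSVD (RMpinv * (Z * QM)ᵀ) U s V ∧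
    L = Matrix.diagonal s ^ 2

/-- The random matrices `Om` and `Ps` are independent standard Gaussian matrices: all their
entries are jointly independent and each entry has the law `N(0, 1)`. -/
def IsStdGaussianPair {S : Type*} [MeasurableSpace S] (P : Measure S) {a b c d : ℕ}
    (Om : S → Matrix (Fin a) (Fin b) ℝ) (Ps : S → Matrix (Fin c) (Fin d) ℝ) : Prop :=
  (∀ i j, HasLaw (fun w => Om w i j) (gaussianReal 0 1) P) ∧
  (∀ i j, HasLaw (fun w => Ps w i j) (gaussianReal 0 1) P) ∧
  iIndepFun
    (Sum.elim (fun (e : Fin a × Fin b) w => Om w e.1 e.2)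
      (fun (e : Fin c × Fin d) w => Ps w e.1 e.2)) P

/-! The Gauss–Newton system -/

/-- The data-misfit Hessian `H = Aᵀ A`. -/
def misfitHessian {m n : ℕ} (A : Matrix (Fin m) (Fin n) ℝ) : Matrix (Fin n) (Fin n) ℝ := Aᵀ * A

theorem misfitHessian_isHermitian {m n : ℕ} (A : Matrix (Fin m) (Fin n) ℝ) :
    (misfitHessian A).IsHermitian := by
  simp [misfitHessian, Matrix.IsHermitian]

/-- The Gauss–Newton matrix `Γ^{-1/2} (I + H) Γ^{-1/2}`. -/
def gnMatrix {n : ℕ} (Γ H : Matrix (Fin n) (Fin n) ℝ) : Matrix (Fin n) (Fin n) ℝ :=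
  (msqrt Γ)⁻¹ * (1 + H) * (msqrt Γ)⁻¹

/-- The step `δx` that solves `Γ^{-1/2} (I + H) Γ^{-1/2} δx = -g`. -/
def gnStep {n : ℕ} (Γ H : Matrix (Fin n) (Fin n) ℝ) (g : Fin n → ℝ) : Fin n → ℝ :=
  -((gnMatrix Γ H)⁻¹ *ᵥ g)

/-- The relative error `‖δx - δx'‖_{Γ⁻¹} / ‖δx‖_{Γ⁻¹}` of the step `δx'` computed with `H'` in
place of `H`. -/
def relStepError {n : ℕ} (Γ H H' : Matrix (Fin n) (Fin n) ℝ) (g : Fin n → ℝ) : ℝ :=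
  weightedNorm Γ⁻¹ (gnStep Γ H g - gnStep Γ H' g) / weightedNorm Γ⁻¹ (gnStep Γ H g)

/-- The preconditioned operator `(I + H')^{-1/2} (I + H) (I + H')^{-1/2}`. -/
def precond {n : ℕ} (H H' : Matrix (Fin n) (Fin n) ℝ) : Matrix (Fin n) (Fin n) ℝ :=
  (msqrt (1 + H'))⁻¹ * (1 + H) * (msqrt (1 + H'))⁻¹

/-- The eigenvalue `λ_{j+1}` of `H = Aᵀ A`, in nonincreasing order and with multiplicity
(so `misfitEig A 0` is `λ₁`; the value is `0` beyond the dimension). -/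
def misfitEig {m n : ℕ} (A : Matrix (Fin m) (Fin n) ℝ) (j : ℕ) : ℝ :=
  if h : j < n then
    (misfitHessian_isHermitian A).eigenvalues₀ ⟨j, by simpa using h⟩
  else 0

/-- `Θ_H = 3 (∑_{j>r} λ₁ λ_j)^{1/2} + (9/4) ∑_{j>r} λ_j`. -/
def theta {m n : ℕ} (A : Matrix (Fin m) (Fin n) ℝ) (r : ℕ) : ℝ :=
  3 * Real.sqrt (∑ j ∈ Finset.Ico r n, misfitEig A 0 * misfitEig A j) +
    9 / 4 * ∑ j ∈ Finset.Ico r n, misfitEig A j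

/-- The intrinsic dimension `id_r = (∑_{j>r} λ_j) / λ_{r+1}` of the tail of the eigenvalues. -/
def intrinsicDim {m n : ℕ} (A : Matrix (Fin m) (Fin n) ℝ) (r : ℕ) : ℝ :=
  (∑ j ∈ Finset.Ico r n, misfitEig A j) / misfitEig A r

end GNSketch

end

/-! Both quantities are controlled by the single number `δ = ‖Ĥ - H‖₂`. The step error is at most
`δ` because `‖(I + Ĥ)⁻¹‖ ≤ 1` (`relStepError_le`). The condition number is a product of two norms,
each at most `1 + δ` (`sqrt_cond2_precond_le`). It remains to show `E δ ≤ Θ_H`.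

Almost surely `Ĥ = WᵀW` with `W = QᵀA + D`, where `Q = Q_Y`, `C = A - QQᵀA` and `D` is the oblique
projection `(QᵀΨ)†ᵀ Ψᵀ C` (`singleViewOutput_eq`, `norm_sketch_sub_le`), while `H = (QᵀA)ᵀ(QᵀA) +
CᵀC`. A bound on the quadratic form of `Ĥ - H` gives `δ ≤ √λ₁ (‖C‖_F + ‖D‖_F²/‖C‖_F) + ‖D‖_F²`,
which is affine in `‖D‖_F²`.

The probabilistic core is `gaussian_oblique_projection`: since `CᵀQ = 0`, the matrix `CᵀΨ` is
independent of `QᵀΨ`, so `E‖D‖_F²` is `‖C‖_F²` times the mean trace of an inverse Gaussian Gram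
matrix. That mean is at most 1 when there are at least `2k + 1` columns for `k` rows. The diagonal
entries of the inverse Gram matrix are reciprocal squared distances from a row to the span of the
others, so the mean reduces to `E[1/χ²_d] = 1/(d - 2)`.

Averaging over `Ψ` leaves `2√λ₁ ‖C‖_F + ‖C‖_F²`. The range finder bound `frobSq_rangeFinder_le` and
the same core lemma, now for `Ω` and the leading eigenvectors, give `E‖C‖_F² ≤ 2τ` with `τ = ∑_{j>r}
λ_j`. Hence `E δ ≤ 2√(2λ₁τ) + 2τ ≤ Θ_H`, using `√2 ≤ 3/2`. -/

noncomputable section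

namespace GNSketch

open scoped ENNReal

/-! Inverse moments of the chi-square distribution -/

/-- The standard Gaussian measure on `κ → ℝ`. -/
abbrev gaussVec (κ : Type*) [Fintype κ] : Measure (κ → ℝ) :=
  Measure.pi fun _ : κ => gaussianReal 0 1

/-- The law of a standard Gaussian matrix with index types `ι` and `κ`. -/
abbrev gaussMat (ι κ : Type*) [Fintype ι] [Fintype κ] : Measure (ι → κ → ℝ) :=
  Measure.pi fun _ : ι => gaussVec κ

theorem integral_exp_neg_mul_sq_gaussianReal {t : ℝ} (ht : 0 ≤ t) :
    ∫ x, Real.exp (-t * x ^ 2) ∂(gaussianReal 0 1) = (Real.sqrt (1 + 2 * t))⁻¹ := by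
  rw [integral_gaussianReal_eq_integral_smul (by norm_num)]
  have h : ∀ x : ℝ, gaussianPDFReal 0 1 x • Real.exp (-t * x ^ 2) =
      (Real.sqrt (2 * Real.pi))⁻¹ * Real.exp (-(t + 1 / 2) * x ^ 2) := by
    intro x
    simp only [gaussianPDFReal, smul_eq_mul, NNReal.coe_one, mul_one, sub_zero]
    rw [mul_assoc, ← Real.exp_add]
    congr 2
    ring
  simp_rw [h]
  rw [integral_const_mul, integral_gaussian, ← Real.sqrt_inv, ← Real.sqrt_inv,
    ← Real.sqrt_mul (by positivity)]
  congr 1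
  have := Real.pi_pos
  field_simp
  ring

theorem integral_exp_neg_mul_sum_sq_gaussVec {κ : Type*} [Fintype κ] (T : Finset κ) {t : ℝ}
    (ht : 0 ≤ t) :
    ∫ x, Real.exp (-t * ∑ a ∈ T, x a ^ 2) ∂(gaussVec κ) = (Real.sqrt (1 + 2 * t))⁻¹ ^ T.card := by
  classical
  have h : ∀ x : κ → ℝ, Real.exp (-t * ∑ a ∈ T, x a ^ 2) =
      ∏ a, (fun (a : κ) (y : ℝ) => if a ∈ T then Real.exp (-t * y ^ 2) else 1) a (x a) := by
    intro x
    simp only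
    rw [Finset.mul_sum, Real.exp_sum, Finset.prod_ite_mem, Finset.univ_inter]
  rw [integral_congr_ae (ae_of_all _ h), integral_fintype_prod_eq_prod (E := fun _ : κ => ℝ)
    (f := fun (a : κ) (y : ℝ) => if a ∈ T then Real.exp (-t * y ^ 2) else 1)]
  have h2 : ∀ a : κ, ∫ y, (if a ∈ T then Real.exp (-t * y ^ 2) else 1) ∂(gaussianReal 0 1) =
      if a ∈ T then (Real.sqrt (1 + 2 * t))⁻¹ else 1 := by
    intro a
    split_ifs
    · exact integral_exp_neg_mul_sq_gaussianReal ht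
    · simp
  simp_rw [h2]
  simp [Finset.prod_ite_mem]

/-- Writes a reciprocal as a Laplace integral, so that inverse moments reduce to exponential ones.
In `ℝ≥0∞` the case `y = 0` is included: both sides are `⊤`. -/
theorem lintegral_exp_neg_mul_eq_inv {y : ℝ} (hy : 0 ≤ y) :
    ∫⁻ t in Set.Ioi (0 : ℝ), ENNReal.ofReal (Real.exp (-t * y)) = (ENNReal.ofReal y)⁻¹ := by
  rcases hy.eq_or_lt with rfl | hy
  · simp
  · have hi : IntegrableOn (fun t : ℝ => Real.exp (-t * y)) (Set.Ioi 0) := by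
      have := integrableOn_exp_mul_Ioi (a := -y) (by linarith) 0
      refine this.congr_fun (fun t _ => ?_) measurableSet_Ioi
      ring_nf
    rw [← ofReal_integral_eq_lintegral_ofReal hi (ae_of_all _ fun _ => (Real.exp_pos _).le),
      ← ENNReal.ofReal_inv_of_pos hy]
    congr 1
    have := integral_exp_mul_Ioi (a := -y) (by linarith) 0
    simp only [mul_zero, Real.exp_zero] at this
    rw [show (fun t : ℝ => Real.exp (-t * y)) = fun t => Real.exp (-y * t) by
      funext t; ring_nf, this]
    field_simp

theorem lintegral_inv_sqrt_pow {d : ℕ} (hd : 3 ≤ d) :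
    ∫⁻ t in Set.Ioi (0 : ℝ), ENNReal.ofReal ((Real.sqrt (1 + 2 * t))⁻¹ ^ d) =
      ENNReal.ofReal (1 / ((d : ℝ) - 2)) := by
  have hd' : (3 : ℝ) ≤ d := by exact_mod_cast hd
  have hderiv : ∀ x ∈ Set.Ici (0 : ℝ), HasDerivAt
      (fun t : ℝ => -((d : ℝ) - 2)⁻¹ * (1 + 2 * t) ^ (-((d : ℝ) - 2) / 2))
      ((Real.sqrt (1 + 2 * x))⁻¹ ^ d) x := by
    intro x hx
    have hx0 : (0 : ℝ) < 1 + 2 * x := by have : (0 : ℝ) ≤ x := hx; linarith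
    have h1 : HasDerivAt (fun t : ℝ => 1 + 2 * t) 2 x := by
      simpa using ((hasDerivAt_id x).const_mul 2).const_add 1
    have h2 := (h1.rpow_const (p := -((d : ℝ) - 2) / 2) (Or.inl hx0.ne')).const_mul
      (-((d : ℝ) - 2)⁻¹)
    refine h2.congr_deriv ?_
    rw [Real.sqrt_eq_rpow, ← Real.rpow_neg hx0.le, ← Real.rpow_natCast, ← Real.rpow_mul hx0.le]
    have : (d : ℝ) - 2 ≠ 0 := by linarith
    have e : -((d : ℝ) - 2) / 2 - 1 = -(1 / 2) * (d : ℝ) := by ring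
    rw [e]
    field_simp
  have hlim : Filter.Tendsto
      (fun t : ℝ => -((d : ℝ) - 2)⁻¹ * (1 + 2 * t) ^ (-((d : ℝ) - 2) / 2))
      Filter.atTop (nhds (-((d : ℝ) - 2)⁻¹ * 0)) := by
    refine Filter.Tendsto.const_mul _ ?_
    have h := tendsto_rpow_neg_atTop (y := ((d : ℝ) - 2) / 2) (by linarith)
    have h2 : Filter.Tendsto (fun t : ℝ => 1 + 2 * t) Filter.atTop Filter.atTop :=
      Filter.tendsto_atTop_add_const_left _ _
        (Filter.tendsto_id.const_mul_atTop (by norm_num : (0 : ℝ) < 2))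
    have := h.comp h2
    simpa only [Function.comp_def, neg_div] using this
  have hpos : ∀ x ∈ Set.Ioi (0 : ℝ), 0 ≤ (Real.sqrt (1 + 2 * x))⁻¹ ^ d := by
    intro x _; positivity
  have hint := integrableOn_Ioi_deriv_of_nonneg' hderiv hpos hlim
  have hval := integral_Ioi_of_hasDerivAt_of_nonneg' hderiv hpos hlim
  rw [← ofReal_integral_eq_lintegral_ofReal hint (ae_of_all _ fun _ => by positivity), hval]
  simp

/-- The mean of `1/χ²_d`: by Tonelli it equals `∫₀^∞ (1 + 2t)^{-d/2} dt`, which converges for `d ≥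
3`. -/
theorem lintegral_inv_sum_sq_gaussVec {κ : Type*} [Fintype κ] (T : Finset κ) (hT : 3 ≤ T.card) :
    ∫⁻ x, (ENNReal.ofReal (∑ a ∈ T, x a ^ 2))⁻¹ ∂(gaussVec κ) =
      ENNReal.ofReal (1 / ((T.card : ℝ) - 2)) := by
  have h : ∀ x : κ → ℝ, (ENNReal.ofReal (∑ a ∈ T, x a ^ 2))⁻¹ =
      ∫⁻ t in Set.Ioi (0 : ℝ), ENNReal.ofReal (Real.exp (-t * ∑ a ∈ T, x a ^ 2)) := fun x =>
    (lintegral_exp_neg_mul_eq_inv (Finset.sum_nonneg fun _ _ => sq_nonneg _)).symm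
  rw [lintegral_congr h, lintegral_lintegral_swap (by fun_prop), ← lintegral_inv_sqrt_pow hT]
  refine setLIntegral_congr_fun measurableSet_Ioi fun t ht => ?_
  have ht0 : (0 : ℝ) ≤ t := (Set.mem_Ioi.1 ht).le
  rw [← integral_exp_neg_mul_sum_sq_gaussVec T ht0,
    ofReal_integral_eq_lintegral_ofReal _ (ae_of_all _ fun _ => (Real.exp_pos _).le)]
  refine Integrable.of_bound (C := 1) (Measurable.aestronglyMeasurable (by fun_prop))
    (ae_of_all _ fun x => ?_)
  rw [Real.norm_eq_abs, abs_of_pos (Real.exp_pos _)]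
  refine Real.exp_le_one_iff.2 ?_
  have : 0 ≤ ∑ a ∈ T, x a ^ 2 := Finset.sum_nonneg fun _ _ => sq_nonneg _
  nlinarith

/-! Invariance properties of Gaussian matrices -/

/-- The linear isometry of Euclidean spaces given by an orthogonal matrix. -/
def orthogonalIsometry {ι ι' : Type*} [Fintype ι] [Fintype ι'] [DecidableEq ι] [DecidableEq ι']
    (U : Matrix ι' ι ℝ) (h1 : Uᵀ * U = 1) (h2 : U * Uᵀ = 1) :
    EuclideanSpace ℝ ι ≃ₗᵢ[ℝ] EuclideanSpace ℝ ι' where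
  toLinearEquiv := (WithLp.linearEquiv 2 ℝ (ι → ℝ)).trans
    ((Matrix.toLin'OfInv (M := Uᵀ) (M' := U) h1 h2).trans (WithLp.linearEquiv 2 ℝ (ι' → ℝ)).symm)
  norm_map' x := by
    rw [EuclideanSpace.norm_eq, EuclideanSpace.norm_eq]
    congr 1
    have h : (U *ᵥ x.ofLp) ⬝ᵥ (U *ᵥ x.ofLp) = x.ofLp ⬝ᵥ x.ofLp := by
      rw [Matrix.dotProduct_mulVec, Matrix.vecMul_mulVec, h1, Matrix.vecMul_one]
    simpa [dotProduct, ← sq] using h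

/-- Rotation invariance of the Gaussian. The index types may differ, so that coordinates can later
be split as `Fin k ⊕ Fin s`. -/
theorem measurePreserving_mulVec {ι ι' : Type*} [Fintype ι] [Fintype ι'] [DecidableEq ι]
    [DecidableEq ι'] (U : Matrix ι' ι ℝ) (h1 : Uᵀ * U = 1) (h2 : U * Uᵀ = 1) :
    MeasurePreserving (fun x : ι → ℝ => U *ᵥ x) (gaussVec ι) (gaussVec ι') where
  measurable := (Continuous.matrix_mulVec continuous_const continuous_id).measurable
  map_eq := by
    have hcomp : (fun x : ι → ℝ => U *ᵥ x) =
        (WithLp.ofLp (p := 2)) ∘ (orthogonalIsometry U h1 h2) ∘ (WithLp.toLp 2) := by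
      funext x
      simp [orthogonalIsometry]
      rfl
    have hof : Measurable (WithLp.ofLp (p := 2) : EuclideanSpace ℝ ι' → (ι' → ℝ)) := by fun_prop
    have hto : Measurable (WithLp.toLp 2 : (ι → ℝ) → EuclideanSpace ℝ ι) := by fun_prop
    have hto' : Measurable (WithLp.toLp 2 : (ι' → ℝ) → EuclideanSpace ℝ ι') := by fun_prop
    have hO : Measurable (orthogonalIsometry U h1 h2) :=
      (orthogonalIsometry U h1 h2).continuous.measurable
    rw [hcomp, ← Measure.map_map hof (hO.comp hto), ← Measure.map_map hO hto,
      map_pi_eq_stdGaussian, stdGaussian_map, ← map_pi_eq_stdGaussian, Measure.map_map hof hto']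
    exact Measure.map_id

theorem measurePreserving_uncurry (ι κ : Type*) [Fintype ι] [Fintype κ] :
    MeasurePreserving (fun (X : ι → κ → ℝ) (p : ι × κ) => X p.1 p.2)
      (gaussMat ι κ) (gaussVec (ι × κ)) where
  measurable := by fun_prop
  map_eq := by
    refine (Measure.pi_eq fun s hs => ?_).symm
    rw [Measure.map_apply (by fun_prop) (MeasurableSet.univ_pi hs)]
    have : (fun (X : ι → κ → ℝ) (p : ι × κ) => X p.1 p.2) ⁻¹' Set.univ.pi s =
        Set.univ.pi fun i => Set.univ.pi fun j => s (i, j) := by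
      ext X
      simp [Set.mem_pi]
    rw [this, Measure.pi_pi]
    simp_rw [Measure.pi_pi]
    rw [Fintype.prod_prod_type]

theorem measurePreserving_transpose (ι κ : Type*) [Fintype ι] [Fintype κ] :
    MeasurePreserving (fun (X : ι → κ → ℝ) (j : κ) (i : ι) => X i j)
      (gaussMat ι κ) (gaussMat κ ι) where
  measurable := by fun_prop
  map_eq := by
    have hm : Measurable (fun (X : ι → κ → ℝ) (j : κ) (i : ι) => X i j) := by fun_prop
    have h1 := (measurePreserving_uncurry κ ι)
    have hswap : MeasurePreserving (fun (x : ι × κ → ℝ) (p : κ × ι) => x p.swap)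
        (gaussVec (ι × κ)) (gaussVec (κ × ι)) :=
      measurePreserving_piCongrLeft (fun _ : κ × ι => gaussianReal 0 1) (Equiv.prodComm ι κ)
    have h2 := hswap.comp (measurePreserving_uncurry ι κ)
    have hemb : MeasurableEmbedding (fun (X : κ → ι → ℝ) (p : κ × ι) => X p.1 p.2) :=
      (MeasurableEquiv.curry κ ι ℝ).symm.measurableEmbedding
    have h3 : ((gaussMat ι κ).map (fun (X : ι → κ → ℝ) (j : κ) (i : ι) => X i j)).map
        (fun (X : κ → ι → ℝ) (p : κ × ι) => X p.1 p.2) = (gaussMat κ ι).map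
        (fun (X : κ → ι → ℝ) (p : κ × ι) => X p.1 p.2) := by
      rw [h1.map_eq, Measure.map_map hemb.measurable hm, ← h2.map_eq]
      rfl
    have := congrArg (Measure.comap (fun (X : κ → ι → ℝ) (p : κ × ι) => X p.1 p.2)) h3
    rwa [hemb.comap_map, hemb.comap_map] at this

/-- The matrix `U` acts separately on each column; transposing makes the columns the independent
factors of the product measure. -/
theorem measurePreserving_mul_left {ι ι' κ : Type*} [Fintype ι] [Fintype ι'] [Fintype κ]
    [DecidableEq ι] [DecidableEq ι'] (U : Matrix ι' ι ℝ) (h1 : Uᵀ * U = 1) (h2 : U * Uᵀ = 1) :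
    MeasurePreserving (fun (X : ι → κ → ℝ) i j => (U * Matrix.of X) i j)
      (gaussMat ι κ) (gaussMat ι' κ) := by
  have := (measurePreserving_transpose κ ι').comp
    ((measurePreserving_pi (fun _ : κ => gaussVec ι) (fun _ : κ => gaussVec ι')
      fun _ => measurePreserving_mulVec U h1 h2).comp (measurePreserving_transpose ι κ))
  exact this

/-- The second moment of a linear form of a standard Gaussian vector. -/
theorem lintegral_sq_linear_gaussVec {κ : Type*} [Fintype κ] (c : κ → ℝ) :
    ∫⁻ x, ENNReal.ofReal ((∑ a, c a * x a) ^ 2) ∂(gaussVec κ) =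
      ENNReal.ofReal (∑ a, c a ^ 2) := by
  have hmem : ∀ a, MemLp (fun x : κ → ℝ => c a * x a) 2 (gaussVec κ) := by
    intro a
    have h : MemLp (id : ℝ → ℝ) 2 (gaussianReal 0 1) := memLp_id_gaussianReal 2
    exact (h.comp_measurePreserving
      (measurePreserving_eval (fun _ : κ => gaussianReal 0 1) a)).const_mul (c a)
  have hsum : MemLp (fun x : κ → ℝ => ∑ a, c a * x a) 2 (gaussVec κ) :=
    memLp_finsetSum _ fun a _ => hmem a
  have hmean : ∫ x, ∑ a, c a * x a ∂(gaussVec κ) = 0 := by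
    rw [integral_finsetSum _ fun a _ => (hmem a).integrable (by norm_num)]
    refine Finset.sum_eq_zero fun a _ => ?_
    rw [integral_const_mul]
    have h : ∫ x : κ → ℝ, x a ∂(gaussVec κ) = ∫ y, y ∂(gaussianReal 0 1) := by
      rw [← (measurePreserving_eval (fun _ : κ => gaussianReal 0 1) a).map_eq,
        integral_map (measurable_pi_apply a).aemeasurable (by fun_prop)]
    rw [h]
    simp
  have hvar := variance_of_integral_eq_zero hsum.aestronglyMeasurable.aemeasurable hmean
  have hvar2 := variance_sum_pi (μ := fun _ : κ => gaussianReal 0 1)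
    (X := fun (a : κ) (y : ℝ) => c a * y)
    (fun a => (memLp_id_gaussianReal 2).const_mul (c a))
  have hone : ∀ a, Var[fun y : ℝ => c a * y; gaussianReal 0 1] = c a ^ 2 := by
    intro a
    rw [variance_const_mul]
    have : Var[fun y : ℝ => y; gaussianReal 0 1] = 1 := by
      simp
    rw [this, mul_one]
  rw [← ofReal_integral_eq_lintegral_ofReal hsum.integrable_sq (ae_of_all _ fun _ => sq_nonneg _)]
  congr 1
  rw [← hvar]
  simp_rw [hone] at hvar2
  rw [← hvar2]
  congr 1
  funext x
  simp

/-! The inverse Gram matrix of a Gaussian matrix -/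

section Gram

variable {ι κ : Type*} [Fintype ι] [Fintype κ] [DecidableEq ι]

/-- The squared distance from the `i`-th row of `X` to the span of the other rows. -/
def rowGap (X : ι → κ → ℝ) (i : ι) : ℝ≥0∞ :=
  ⨅ c : ι → ℝ, ENNReal.ofReal (∑ a, (X i a + ∑ j ∈ Finset.univ.erase i, c j * X j a) ^ 2)

/-- The infimum is uncountable, but an infimum of continuous functions is upper semicontinuous. -/
theorem measurable_rowGap (i : ι) : Measurable fun X : ι → κ → ℝ => rowGap X i := by
  refine UpperSemicontinuous.measurable (upperSemicontinuous_iInf fun c => ?_)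
  exact (ENNReal.continuous_ofReal.comp (by fun_prop)).upperSemicontinuous

/-- A basis of the whole space, not just of `Wᗮ`, is needed: its coordinates are then a standard
Gaussian vector, and those in `T` do not see `W`. -/
theorem exists_orthonormalBasis_orthogonal {E : Type*} [NormedAddCommGroup E]
    [InnerProductSpace ℝ E] [FiniteDimensional ℝ E] (W : Submodule ℝ E) :
    ∃ (b : OrthonormalBasis (Fin (Module.finrank ℝ E)) ℝ E)
      (T : Finset (Fin (Module.finrank ℝ E))),
      Module.finrank ℝ W + T.card = Module.finrank ℝ E ∧
      ∀ a ∈ T, ∀ w ∈ W, inner ℝ (b a) w = 0 := by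
  classical
  set e := stdOrthonormalBasis ℝ Wᗮ
  set v : Fin (Module.finrank ℝ E) → E := fun i =>
    if h : (i : ℕ) < Module.finrank ℝ Wᗮ then (e ⟨i, h⟩ : E) else 0 with hv
  set s : Set (Fin (Module.finrank ℝ E)) := {i | (i : ℕ) < Module.finrank ℝ Wᗮ} with hs
  have hdim := W.finrank_add_finrank_orthogonal
  have hon : Orthonormal ℝ (s.domRestrict v) := by
    have h1 : Orthonormal ℝ (fun i => (e i : E)) :=
      e.orthonormal.comp_linearIsometry (Wᗮ).subtypeₗᵢ
    have h2 := h1.comp (fun i : s => (⟨((i : Fin (Module.finrank ℝ E)) : ℕ), i.2⟩ :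
        Fin (Module.finrank ℝ Wᗮ)))
      (fun i j hij => Subtype.ext (Fin.ext (Fin.mk.inj_iff.1 hij)))
    convert h2 using 1
    funext i
    have hi : ((i : Fin (Module.finrank ℝ E)) : ℕ) < Module.finrank ℝ Wᗮ := i.2
    simp [Set.domRestrict, hv, hi]
  obtain ⟨b, hb⟩ := hon.exists_orthonormalBasis_extension_of_card_eq (by simp)
  refine ⟨b, Finset.univ.filter fun i => (i : ℕ) < Module.finrank ℝ Wᗮ, ?_, ?_⟩
  · rw [← hdim]
    congr 1
    rw [Fin.card_filter_val_lt]
    omega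
  · intro a ha w hw
    have ha' : (a : ℕ) < Module.finrank ℝ Wᗮ := by simpa using ha
    rw [hb a ha']
    simp only [hv, ha', dite_true]
    exact (Submodule.mem_orthogonal' _ _).1 (e ⟨a, ha'⟩).2 w hw

/-- With the other rows frozen, the gap dominates a `χ²` variable with at least `card κ - card ι +
1` degrees of freedom. There may be more of them, since the frozen rows can be dependent; hence an
inequality. -/
theorem lintegral_inv_rowGap_update (X : ι → κ → ℝ) (i : ι)
    (hcard : Fintype.card ι + 2 ≤ Fintype.card κ) :
    ∫⁻ y, (rowGap (Function.update X i y) i)⁻¹ ∂(gaussVec κ) ≤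
      ENNReal.ofReal (1 / ((Fintype.card κ : ℝ) - Fintype.card ι - 1)) := by
  set W : Submodule ℝ (EuclideanSpace ℝ κ) :=
    Submodule.span ℝ (Set.range fun j : {j // j ≠ i} => WithLp.toLp 2 (X j)) with hW
  have hWdim : Module.finrank ℝ W + 1 ≤ Fintype.card ι := by
    have h1 : Module.finrank ℝ W ≤ Fintype.card {j // j ≠ i} := finrank_range_le_card _
    have h2 : Fintype.card {j // j ≠ i} = Fintype.card ι - 1 := by simp
    have h3 : 0 < Fintype.card ι := Fintype.card_pos_iff.2 ⟨i⟩
    omega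
  obtain ⟨b, T, hcT, hT⟩ := exists_orthonormalBasis_orthogonal W
  have hfin : Module.finrank ℝ (EuclideanSpace ℝ κ) = Fintype.card κ := finrank_euclideanSpace
  have hT3 : 3 ≤ T.card := by omega
  have hlaw : gaussVec κ = (gaussVec (Fin (Module.finrank ℝ (EuclideanSpace ℝ κ)))).map
      fun z => WithLp.ofLp (∑ a, z a • b a) := by
    have h1 := stdGaussian_eq_map_pi_orthonormalBasis b
    rw [← map_pi_eq_stdGaussian] at h1
    have h2 := congrArg (Measure.map (WithLp.ofLp : EuclideanSpace ℝ κ → κ → ℝ)) h1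
    rw [Measure.map_map (by fun_prop) (by fun_prop), Measure.map_map (by fun_prop)
      (by fun_prop)] at h2
    exact Measure.map_id.symm.trans h2
  rw [hlaw]
  refine (lintegral_map_le _ _).trans ?_
  have hpt : ∀ z : Fin (Module.finrank ℝ (EuclideanSpace ℝ κ)) → ℝ,
      (rowGap (Function.update X i (WithLp.ofLp (∑ a, z a • b a))) i)⁻¹ ≤
        (ENNReal.ofReal (∑ a ∈ T, z a ^ 2))⁻¹ := by
    intro z
    refine ENNReal.inv_le_inv.2 (le_iInf fun c => ENNReal.ofReal_le_ofReal ?_)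
    set s : EuclideanSpace ℝ κ := ∑ j ∈ Finset.univ.erase i, c j • WithLp.toLp 2 (X j) with hs
    have hsW : s ∈ W := by
      refine Submodule.sum_mem _ fun j hj => Submodule.smul_mem _ _ (Submodule.subset_span ?_)
      exact ⟨⟨j, (Finset.mem_erase.1 hj).1⟩, rfl⟩
    have hnorm : ∑ a, (Function.update X i (WithLp.ofLp (∑ a, z a • b a)) i a +
        ∑ j ∈ Finset.univ.erase i,
          c j * Function.update X i (WithLp.ofLp (∑ a, z a • b a)) j a) ^ 2 =
        ‖(∑ a, z a • b a) + s‖ ^ 2 := by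
      rw [EuclideanSpace.real_norm_sq_eq]
      refine Finset.sum_congr rfl fun a _ => ?_
      congr 1
      rw [Function.update_self, PiLp.add_apply, hs]
      congr 1
      refine Eq.trans ?_ (congrFun (WithLp.ofLp_sum 2 (V := κ → ℝ) (Finset.univ.erase i)
        fun j => c j • WithLp.toLp 2 (X j)) a).symm
      rw [Finset.sum_apply]
      refine Finset.sum_congr rfl fun j hj => ?_
      rw [Function.update_of_ne (Finset.mem_erase.1 hj).1]
      simp
    rw [hnorm, ← b.sum_sq_inner_right]
    -- Only the coordinates in `T` are kept, and there the combination `s` of the other rows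
    -- contributes nothing.
    refine le_trans (Finset.sum_le_sum fun a ha => ?_)
      (Finset.sum_le_sum_of_subset_of_nonneg (Finset.subset_univ T) fun _ _ _ => sq_nonneg _)
    rw [inner_add_right, hT a ha s hsW, add_zero, b.orthonormal.inner_right_fintype]
  refine (lintegral_mono hpt).trans ?_
  rw [lintegral_inv_sum_sq_gaussVec T hT3]
  refine ENNReal.ofReal_le_ofReal ?_
  have h1 : (Fintype.card κ : ℝ) - Fintype.card ι - 1 ≤ (T.card : ℝ) - 2 := by
    have : Fintype.card κ + 1 ≤ T.card + Fintype.card ι := by omega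
    have : (Fintype.card κ : ℝ) + 1 ≤ T.card + Fintype.card ι := by exact_mod_cast this
    linarith
  have h2 : (0 : ℝ) < (Fintype.card κ : ℝ) - Fintype.card ι - 1 := by
    have : (Fintype.card ι : ℝ) + 2 ≤ Fintype.card κ := by exact_mod_cast hcard
    linarith
  exact one_div_le_one_div_of_le h2 h1

/-- Row `i` is integrated first; the bound obtained is uniform in the remaining rows. -/
theorem lintegral_inv_rowGap (i : ι) (hcard : Fintype.card ι + 2 ≤ Fintype.card κ) :
    ∫⁻ X, (rowGap X i)⁻¹ ∂(gaussMat ι κ) ≤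
      ENNReal.ofReal (1 / ((Fintype.card κ : ℝ) - Fintype.card ι - 1)) := by
  set K := ENNReal.ofReal (1 / ((Fintype.card κ : ℝ) - Fintype.card ι - 1))
  have hm : Measurable fun X : ι → κ → ℝ => (rowGap X i)⁻¹ := (measurable_rowGap i).inv
  have h := lintegral_le_of_lmarginal_le (μ := fun _ : ι => gaussVec κ) {i} hm
    (measurable_const (a := K)) (fun X => by
      rw [lmarginal_singleton, lmarginal_singleton]
      refine (lintegral_inv_rowGap_update X i hcard).trans ?_
      simp [K])
  simpa using h

/-- A null vector `v` of the Gram matrix satisfies `Xᵀv = 0`; dividing by some `v i ≠ 0` expresses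
row `i` through the others. -/
theorem isUnit_det_gram_of_rowGap_ne_zero (X : Matrix ι κ ℝ) (h : ∀ i, rowGap X i ≠ 0) :
    IsUnit (X * Xᵀ).det := by
  rw [isUnit_iff_ne_zero]
  intro hdet
  obtain ⟨v, hv, hv0⟩ := Matrix.exists_mulVec_eq_zero_iff.2 hdet
  have hz : Xᵀ *ᵥ v = 0 := by
    have : (Xᵀ *ᵥ v) ⬝ᵥ (Xᵀ *ᵥ v) = 0 := by
      rw [Matrix.dotProduct_mulVec, Matrix.vecMul_transpose, Matrix.mulVec_mulVec, hv0,
        zero_dotProduct]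
    exact dotProduct_self_eq_zero.1 this
  obtain ⟨i, hi⟩ := Function.ne_iff.1 hv
  refine h i (le_antisymm ((iInf_le _ fun j => v j / v i).trans ?_) (zero_le))
  rw [ENNReal.ofReal_le_iff_le_toReal ENNReal.zero_ne_top]
  refine le_of_eq (Finset.sum_eq_zero fun a _ => ?_)
  have ha : ∑ j, X j a * v j = 0 := congrFun hz a
  rw [← Finset.add_sum_erase _ _ (Finset.mem_univ i)] at ha
  have hi' : v i ≠ 0 := hi
  have : X i a + ∑ j ∈ Finset.univ.erase i, v j / v i * X j a =
      (X i a * v i + ∑ j ∈ Finset.univ.erase i, X j a * v j) / v i := by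
    rw [add_div, mul_div_cancel_right₀ _ hi', Finset.sum_div]
    congr 1
    exact Finset.sum_congr rfl fun j _ => by ring
  rw [this, ha]
  simp

/-- In fact equality holds. For the inequality it suffices to test the infimum with row `i` of `N⁻¹`
divided by `q = N⁻¹ i i`: the resulting vector has squared norm `q / q² = 1/q`. -/
theorem ofReal_inv_gram_le_inv_rowGap (X : Matrix ι κ ℝ) (h : IsUnit (X * Xᵀ).det) (i : ι) :
    ENNReal.ofReal ((X * Xᵀ)⁻¹ i i) ≤ (rowGap X i)⁻¹ := by
  set N := X * Xᵀ with hN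
  set q := N⁻¹ i i with hq
  rcases le_or_gt q 0 with hq0 | hq0
  · rw [ENNReal.ofReal_eq_zero.2 hq0]; exact zero_le
  rw [← inv_inv (ENNReal.ofReal q), ENNReal.inv_le_inv, ← ENNReal.ofReal_inv_of_pos hq0]
  refine (iInf_le _ fun j => N⁻¹ i j / q).trans (ENNReal.ofReal_le_ofReal (le_of_eq ?_))
  have hrow : ∀ a, X i a + ∑ j ∈ Finset.univ.erase i, N⁻¹ i j / q * X j a =
      (N⁻¹ * X) i a / q := by
    intro a
    rw [Matrix.mul_apply, ← Finset.add_sum_erase _ _ (Finset.mem_univ i), add_div,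
      Finset.sum_div, ← hq, mul_div_cancel_left₀ _ hq0.ne']
    congr 1
    exact Finset.sum_congr rfl fun j _ => by ring
  simp_rw [hrow]
  have hNT : Nᵀ = N := by rw [hN, Matrix.transpose_mul, Matrix.transpose_transpose]
  have hY : ((N⁻¹ * X) * (N⁻¹ * X)ᵀ) i i = q := by
    rw [Matrix.transpose_mul, Matrix.transpose_nonsing_inv, hNT, Matrix.mul_assoc,
      ← Matrix.mul_assoc X, ← hN, Matrix.mul_nonsing_inv _ h, Matrix.mul_one]
  simp_rw [div_pow]
  rw [← Finset.sum_div]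
  have : ∑ a, (N⁻¹ * X) i a ^ 2 = q := by
    rw [← hY, Matrix.mul_apply]
    exact Finset.sum_congr rfl fun a _ => by rw [Matrix.transpose_apply, sq]
  rw [this]
  field_simp

/-- A finite mean of `1 / rowGap` forces the gaps to be nonzero almost surely. -/
theorem ae_isUnit_det_gram (hcard : Fintype.card ι + 2 ≤ Fintype.card κ) :
    ∀ᵐ X ∂(gaussMat ι κ), IsUnit (Matrix.of X * (Matrix.of X)ᵀ).det := by
  have h : ∀ i, ∀ᵐ X ∂(gaussMat ι κ), rowGap X i ≠ 0 := by
    intro i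
    have hlt : ∫⁻ X, (rowGap X i)⁻¹ ∂(gaussMat ι κ) ≠ ⊤ :=
      ((lintegral_inv_rowGap i hcard).trans_lt ENNReal.ofReal_lt_top).ne
    filter_upwards [ae_lt_top (measurable_rowGap i).inv hlt] with X hX h0
    simp [h0] at hX
  filter_upwards [ae_all_iff.2 h] with X hX
  exact isUnit_det_gram_of_rowGap_ne_zero _ hX

/-- The sum is bounded by `card ι / (card κ - card ι - 1)`, which is at most 1 exactly under the
oversampling `card κ ≥ 2 card ι + 1` (for nonempty `ι`). -/
theorem lintegral_trace_inv_gram_le (hcard : 2 * Fintype.card ι + 1 ≤ Fintype.card κ) :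
    ∫⁻ X, ENNReal.ofReal (∑ i, (Matrix.of X * (Matrix.of X)ᵀ)⁻¹ i i) ∂(gaussMat ι κ) ≤ 1 := by
  rcases isEmpty_or_nonempty ι with hι | hι
  · simp
  have hpos : 0 < Fintype.card ι := Fintype.card_pos
  have hc2 : Fintype.card ι + 2 ≤ Fintype.card κ := by omega
  calc ∫⁻ X, ENNReal.ofReal (∑ i, (Matrix.of X * (Matrix.of X)ᵀ)⁻¹ i i) ∂(gaussMat ι κ)
      ≤ ∫⁻ X, ∑ i, (rowGap X i)⁻¹ ∂(gaussMat ι κ) := by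
        refine lintegral_mono_ae ?_
        filter_upwards [ae_isUnit_det_gram hc2] with X hX
        refine (Finset.le_sum_of_subadditive ENNReal.ofReal ENNReal.ofReal_zero.le
          (fun _ _ => ENNReal.ofReal_add_le) _ _).trans (Finset.sum_le_sum fun i _ => ?_)
        exact ofReal_inv_gram_le_inv_rowGap (Matrix.of X) hX i
    _ = ∑ i, ∫⁻ X, (rowGap X i)⁻¹ ∂(gaussMat ι κ) :=
        lintegral_finsetSum _ fun i _ => (measurable_rowGap i).inv
    _ ≤ ∑ _i : ι, ENNReal.ofReal (1 / ((Fintype.card κ : ℝ) - Fintype.card ι - 1)) :=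
        Finset.sum_le_sum fun i _ => lintegral_inv_rowGap i hc2
    _ ≤ 1 := by
        have h2 : (2 : ℝ) * Fintype.card ι + 1 ≤ Fintype.card κ := by exact_mod_cast hcard
        have hp : (0 : ℝ) < Fintype.card ι := by exact_mod_cast hpos
        rw [Finset.sum_const, Finset.card_univ, nsmul_eq_mul, ← ENNReal.ofReal_natCast,
          ← ENNReal.ofReal_mul (by positivity), ← ENNReal.ofReal_one]
        refine ENNReal.ofReal_le_ofReal ?_
        rw [mul_one_div, div_le_one (by linarith)]
        linarith

end Gram

/-! Measurability of matrix operations -/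

section Measurability

variable {α ι κ σ : Type*} [MeasurableSpace α]

/-- The entries of the matrix-valued function `M` are measurable. -/
def EntryMeasurable (M : α → Matrix ι κ ℝ) : Prop := ∀ i j, Measurable fun x => M x i j

namespace EntryMeasurable

theorem const (M : Matrix ι κ ℝ) : EntryMeasurable fun _ : α => M := fun _ _ => measurable_const

theorem of_measurable {f : α → ι → κ → ℝ} (hf : Measurable f) :
    EntryMeasurable fun x => Matrix.of (f x) := fun i j =>
  (measurable_pi_apply j).comp ((measurable_pi_apply i).comp hf)

theorem mul [Fintype κ] {M : α → Matrix ι κ ℝ} {N : α → Matrix κ σ ℝ} (hM : EntryMeasurable M)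
    (hN : EntryMeasurable N) : EntryMeasurable fun x => M x * N x := by
  intro i j
  simp_rw [Matrix.mul_apply]
  exact Finset.measurable_sum _ fun k _ => (hM i k).mul (hN k j)

theorem add {M N : α → Matrix ι κ ℝ} (hM : EntryMeasurable M)
    (hN : EntryMeasurable N) : EntryMeasurable fun x => M x + N x := fun i j =>
  (hM i j).add (hN i j)

theorem sub {M N : α → Matrix ι κ ℝ} (hM : EntryMeasurable M)
    (hN : EntryMeasurable N) : EntryMeasurable fun x => M x - N x := fun i j =>
  (hM i j).sub (hN i j)

theorem transpose {M : α → Matrix ι κ ℝ} (hM : EntryMeasurable M) :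
    EntryMeasurable fun x => (M x)ᵀ := fun i j => hM j i

theorem det [Fintype ι] [DecidableEq ι] {M : α → Matrix ι ι ℝ} (hM : EntryMeasurable M) :
    Measurable fun x => (M x).det := by
  simp_rw [Matrix.det_apply']
  exact Finset.measurable_sum _ fun τ _ => measurable_const.mul
    (Finset.measurable_prod _ fun i _ => hM _ _)

/-- By Cramer's formula, which also describes the value at singular matrices, where the inverse of
the determinant is 0. -/
theorem inv [Fintype ι] [DecidableEq ι] {M : α → Matrix ι ι ℝ} (hM : EntryMeasurable M) :
    EntryMeasurable fun x => (M x)⁻¹ := by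
  intro i j
  simp_rw [Matrix.inv_def, Matrix.smul_apply, Ring.inverse_eq_inv', Matrix.adjugate_apply]
  refine hM.det.inv.smul (EntryMeasurable.det fun a b => ?_)
  simp_rw [Matrix.updateRow_apply]
  split_ifs
  · exact measurable_const
  · exact hM a b

end EntryMeasurable

end Measurability

/-! The expected Frobenius norm of an oblique Gaussian projection -/

section Frobenius

variable {ι κ σ : Type*} [Fintype ι] [Fintype κ] [Fintype σ]

/-- The squared Frobenius norm. -/
def frobSq (M : Matrix ι κ ℝ) : ℝ := ∑ i, ∑ j, M i j ^ 2

theorem frobSq_nonneg (M : Matrix ι κ ℝ) : 0 ≤ frobSq M :=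
  Finset.sum_nonneg fun _ _ => Finset.sum_nonneg fun _ _ => sq_nonneg _

theorem frobSq_eq_trace (M : Matrix ι κ ℝ) : frobSq M = (M * Mᵀ).trace := by
  simp [frobSq, Matrix.trace, Matrix.mul_apply, sq]

theorem frobSq_transpose (M : Matrix ι κ ℝ) : frobSq Mᵀ = frobSq M := Finset.sum_comm

theorem frobSq_mul_of_orthogonal [DecidableEq κ] (M : Matrix ι κ ℝ) (U : Matrix κ σ ℝ)
    (hU : U * Uᵀ = 1) : frobSq (M * U) = frobSq M := by
  rw [frobSq_eq_trace, frobSq_eq_trace, Matrix.transpose_mul, Matrix.mul_assoc,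
    ← Matrix.mul_assoc U, hU, Matrix.one_mul]

/-- The right inverse `Bᵀ (B Bᵀ)⁻¹` of a matrix of full row rank. -/
def rightInv [DecidableEq ι] (B : Matrix ι κ ℝ) : Matrix κ ι ℝ := Bᵀ * (B * Bᵀ)⁻¹

theorem EntryMeasurable.frobSq {α : Type*} [MeasurableSpace α] {M : α → Matrix ι κ ℝ}
    (hM : EntryMeasurable M) : Measurable fun x => frobSq (M x) :=
  Finset.measurable_sum _ fun i _ => Finset.measurable_sum _ fun j _ => (hM i j).pow_const 2

theorem EntryMeasurable.rightInv [DecidableEq ι] {α : Type*} [MeasurableSpace α]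
    {M : α → Matrix ι κ ℝ} (hM : EntryMeasurable M) : EntryMeasurable fun x => rightInv (M x) :=
  hM.transpose.mul (hM.mul hM.transpose).inv

theorem frobSq_rightInv [DecidableEq ι] (B : Matrix ι κ ℝ) (h : IsUnit (B * Bᵀ).det) :
    frobSq (rightInv B) = ∑ i, (B * Bᵀ)⁻¹ i i := by
  rw [← frobSq_transpose, frobSq_eq_trace, Matrix.transpose_transpose, rightInv,
    Matrix.transpose_mul, Matrix.transpose_transpose, Matrix.transpose_nonsing_inv,
    Matrix.transpose_mul, Matrix.transpose_transpose, Matrix.mul_assoc, ← Matrix.mul_assoc B,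
    Matrix.mul_nonsing_inv _ h, Matrix.mul_one]
  rfl

/-- Entry `(a, b)` is a linear form in the Gaussian entries with coefficients `B a i * G j b`; the
sum of all their squares factorizes. -/
theorem lintegral_frobSq_mul_gaussMat_mul {τ : Type*} [Fintype τ] (B : Matrix σ ι ℝ)
    (G : Matrix κ τ ℝ) :
    ∫⁻ X, ENNReal.ofReal (frobSq (B * Matrix.of X * G)) ∂(gaussMat ι κ) =
      ENNReal.ofReal (frobSq B * frobSq G) := by
  have hentry : ∀ (X : ι → κ → ℝ) a b, (B * Matrix.of X * G) a b =
      ∑ p : ι × κ, (B a p.1 * G p.2 b) * X p.1 p.2 := by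
    intro X a b
    rw [Fintype.sum_prod_type_right, Matrix.mul_apply]
    refine Finset.sum_congr rfl fun j _ => ?_
    rw [Matrix.mul_apply, Finset.sum_mul]
    exact Finset.sum_congr rfl fun i _ => by simp only [Matrix.of_apply]; ring
  have hone : ∀ a b, ∫⁻ X, ENNReal.ofReal ((B * Matrix.of X * G) a b ^ 2) ∂(gaussMat ι κ) =
      ENNReal.ofReal (∑ p : ι × κ, (B a p.1 * G p.2 b) ^ 2) := by
    intro a b
    rw [← lintegral_sq_linear_gaussVec, ← (measurePreserving_uncurry ι κ).map_eq,
      lintegral_map (by fun_prop) (measurePreserving_uncurry ι κ).measurable]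
    simp_rw [hentry]
  have hm : ∀ a b, Measurable fun X : ι → κ → ℝ =>
      ENNReal.ofReal ((B * Matrix.of X * G) a b ^ 2) := by
    intro a b
    simp_rw [hentry]
    fun_prop
  have hsplit : ∀ X : ι → κ → ℝ, ENNReal.ofReal (frobSq (B * Matrix.of X * G)) =
      ∑ a, ∑ b, ENNReal.ofReal ((B * Matrix.of X * G) a b ^ 2) := by
    intro X
    refine (ENNReal.ofReal_sum_of_nonneg
      fun _ _ => Finset.sum_nonneg fun _ _ => sq_nonneg _).trans ?_
    exact Finset.sum_congr rfl fun a _ => ENNReal.ofReal_sum_of_nonneg fun _ _ => sq_nonneg _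
  rw [lintegral_congr hsplit,
    lintegral_finsetSum _ fun a _ => Finset.measurable_sum _ fun b _ => hm a b]
  simp_rw [lintegral_finsetSum _ fun b _ => hm _ b, hone]
  simp_rw [← ENNReal.ofReal_sum_of_nonneg (s := Finset.univ)
    fun b _ => Finset.sum_nonneg fun (p : ι × κ) (_ : p ∈ Finset.univ) =>
      sq_nonneg (B _ p.1 * G p.2 b)]
  rw [← ENNReal.ofReal_sum_of_nonneg fun _ _ => Finset.sum_nonneg fun _ _ =>
    Finset.sum_nonneg fun _ _ => sq_nonneg _]
  congr 1
  rw [frobSq, frobSq, Finset.sum_mul]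
  refine Finset.sum_congr rfl fun a _ => ?_
  rw [Finset.sum_comm, Fintype.sum_prod_type, Finset.sum_mul]
  refine Finset.sum_congr rfl fun i _ => ?_
  rw [Finset.mul_sum]
  refine Finset.sum_congr rfl fun j _ => ?_
  rw [Finset.mul_sum]
  exact Finset.sum_congr rfl fun b _ => by ring

/-- Freezing `X.1` and averaging over `X.2` gives `frobSq B` times the trace of the inverse Gram
matrix of `X.1`, whose mean is at most 1. -/
theorem lintegral_frobSq_mul_rightInv_prod {ι' : Type*} [Fintype ι'] [DecidableEq ι]
    (hcard : 2 * Fintype.card ι + 1 ≤ Fintype.card κ) (B : Matrix σ ι' ℝ) :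
    ∫⁻ X, ENNReal.ofReal (frobSq (B * Matrix.of X.2 * rightInv (Matrix.of X.1)))
      ∂((gaussMat ι κ).prod (gaussMat ι' κ)) ≤ ENNReal.ofReal (frobSq B) := by
  rcases isEmpty_or_nonempty ι with hι | hι
  · simp [frobSq]
  have hc2 : Fintype.card ι + 2 ≤ Fintype.card κ := by
    have : 0 < Fintype.card ι := Fintype.card_pos
    omega
  refine (lintegral_prod_le _).trans ?_
  simp_rw [lintegral_frobSq_mul_gaussMat_mul, ENNReal.ofReal_mul (frobSq_nonneg B)]
  rw [lintegral_const_mul' _ _ ENNReal.ofReal_ne_top]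
  refine (mul_le_mul_right (le_trans (le_of_eq ?_) (lintegral_trace_inv_gram_le hcard)) _).trans
    (mul_one _).le
  refine lintegral_congr_ae ?_
  filter_upwards [ae_isUnit_det_gram hc2] with X hX
  rw [frobSq_rightInv _ hX]

theorem exists_orthogonal_extension [DecidableEq ι] {k : ℕ} (Q : Matrix ι (Fin k) ℝ)
    (hQ : Qᵀ * Q = 1) :
    ∃ (s : ℕ) (U : Matrix ι (Fin k ⊕ Fin s) ℝ), Uᵀ * U = 1 ∧ U * Uᵀ = 1 ∧
      ∀ i j, U i (Sum.inl j) = Q i j := by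
  set q : Fin k → EuclideanSpace ℝ ι := fun j => WithLp.toLp 2 fun i => Q i j with hq
  have hon : Orthonormal ℝ q := by
    rw [orthonormal_iff_ite]
    intro a b
    have := congrFun (congrFun hQ a) b
    rw [Matrix.mul_apply, Matrix.one_apply] at this
    rw [← this, PiLp.inner_apply]
    exact Finset.sum_congr rfl fun i _ => by simp [hq, mul_comm]
  have hk : k ≤ Fintype.card ι := by
    have := hon.linearIndependent.fintype_card_le_finrank
    simpa using this
  set s := Fintype.card ι - k
  have hcard : Fintype.card ι = Fintype.card (Fin k ⊕ Fin s) := by simp [s]; omega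
  set v : Fin k ⊕ Fin s → EuclideanSpace ℝ ι := Sum.elim q 0
  have hv : Orthonormal ℝ ((Set.range Sum.inl).domRestrict v) := by
    have h := hon.comp
      (Equiv.ofInjective (Sum.inl : Fin k → Fin k ⊕ Fin s) Sum.inl_injective).symm
      (Equiv.injective _)
    convert h using 1
    funext ⟨x, y, hy⟩
    subst hy
    simp [Set.domRestrict, v]
  obtain ⟨b, hb⟩ := hv.exists_orthonormalBasis_extension_of_card_eq
    (by rw [finrank_euclideanSpace, hcard])
  have hU : (Matrix.of fun i a => b a i : Matrix ι (Fin k ⊕ Fin s) ℝ)ᵀ *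
      (Matrix.of fun i a => b a i) = 1 := by
    ext a c
    have := orthonormal_iff_ite.1 b.orthonormal a c
    rw [PiLp.inner_apply] at this
    rw [Matrix.mul_apply, Matrix.one_apply, ← this]
    exact Finset.sum_congr rfl fun i _ => by simp [mul_comm]
  refine ⟨s, Matrix.of fun i a => b a i, hU, ?_, ?_⟩
  · exact (Matrix.mul_eq_one_comm_of_card_eq _ _ _ hcard.symm).1 hU
  · intro i j
    rw [Matrix.of_apply, hb (Sum.inl j) ⟨j, rfl⟩]
    rfl

/-- Complete `Q` to an orthogonal `U = [Q Q']`. The blocks `QᵀX` and `Q'ᵀX` of the Gaussian matrix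
`UᵀX` are independent, and `C * Q = 0` means that `C * X` depends only on the second. This is
applied both to `Ω` and to `Ψ`. -/
theorem gaussian_oblique_projection [DecidableEq ι] {k : ℕ} (Q : Matrix ι (Fin k) ℝ)
    (hQ : Qᵀ * Q = 1) (hcard : 2 * k + 1 ≤ Fintype.card κ) (C : Matrix σ ι ℝ) (hC : C * Q = 0) :
    (∀ᵐ X ∂(gaussMat ι κ), IsUnit ((Qᵀ * Matrix.of X) * (Qᵀ * Matrix.of X)ᵀ).det) ∧
    ∫⁻ X, ENNReal.ofReal (frobSq (C * Matrix.of X * rightInv (Qᵀ * Matrix.of X)))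
      ∂(gaussMat ι κ) ≤ ENNReal.ofReal (frobSq C) := by
  obtain ⟨s, U, hU1, hU2, hUQ⟩ := exists_orthogonal_extension Q hQ
  set Q' : Matrix ι (Fin s) ℝ := Matrix.of fun i j => U i (Sum.inr j) with hQ'
  have hUcols : U = Matrix.fromCols Q Q' := by
    ext i (j | j)
    · simp [hUQ]
    · simp [hQ']
  have hmp := (measurePreserving_sumPiEquivProdPi (X := fun _ : Fin k ⊕ Fin s => κ → ℝ)
    (fun _ => gaussVec κ)).comp
    (measurePreserving_mul_left (κ := κ) Uᵀ (by simpa using hU2) (by simpa using hU1))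
  set f : (ι → κ → ℝ) → (Fin k → κ → ℝ) × (Fin s → κ → ℝ) :=
    fun X => (fun i j => (Qᵀ * Matrix.of X) i j, fun i j => (Q'ᵀ * Matrix.of X) i j) with hf
  have hfmp : MeasurePreserving f (gaussMat ι κ)
      ((gaussMat (Fin k) κ).prod (gaussMat (Fin s) κ)) := by
    have hfun : f = (MeasurableEquiv.sumPiEquivProdPi fun _ : Fin k ⊕ Fin s => κ → ℝ) ∘
        fun X i j => (Uᵀ * Matrix.of X) i j := by
      funext X
      refine Prod.ext ?_ ?_
      · funext i j
        change (Qᵀ * Matrix.of X) i j = (Uᵀ * Matrix.of X) (Sum.inl i) j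
        simp [Matrix.mul_apply, hUQ]
      · rfl
    rw [hfun]
    exact hmp
  have hCX : ∀ X : ι → κ → ℝ, C * Matrix.of X = (C * Q') * (Q'ᵀ * Matrix.of X) := by
    intro X
    have : Q * Qᵀ + Q' * Q'ᵀ = 1 := by
      rw [← hU2, hUcols, Matrix.transpose_fromCols, Matrix.fromCols_mul_fromRows]
    calc C * Matrix.of X = C * (Q * Qᵀ + Q' * Q'ᵀ) * Matrix.of X := by
          rw [this, Matrix.mul_one]
      _ = _ := by
          rw [Matrix.mul_add, ← Matrix.mul_assoc C Q, hC, Matrix.zero_mul, zero_add]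
          simp only [Matrix.mul_assoc]
  have hCF : frobSq (C * Q') = frobSq C := by
    rw [← frobSq_mul_of_orthogonal C U hU2, hUcols, Matrix.mul_fromCols, hC]
    simp [frobSq, Fintype.sum_sum_type]
  refine ⟨?_, ?_⟩
  -- For `k = 0` the determinant is that of the empty matrix, namely 1; for `k > 0` one has `k + 2 ≤
  -- 2k + 1`.
  · rcases Nat.eq_zero_or_pos k with rfl | hk
    · simp
    · have h1 := ae_isUnit_det_gram (ι := Fin k) (κ := κ) (by rw [Fintype.card_fin]; omega)
      exact hfmp.quasiMeasurePreserving.ae (Measure.quasiMeasurePreserving_fst.ae h1)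
  · rw [← hCF]
    refine le_trans (le_of_eq ?_) (lintegral_frobSq_mul_rightInv_prod (ι := Fin k) (ι' := Fin s)
      (κ := κ) (by simpa using hcard) (C * Q'))
    rw [← hfmp.map_eq, lintegral_map ?_ hfmp.measurable]
    · simp_rw [hCX]
      rfl
    · have h1 := EntryMeasurable.of_measurable
        (measurable_fst : Measurable (Prod.fst : (Fin k → κ → ℝ) × (Fin s → κ → ℝ) → _))
      have h2 := EntryMeasurable.of_measurable
        (measurable_snd : Measurable (Prod.snd : (Fin k → κ → ℝ) × (Fin s → κ → ℝ) → _))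
      exact (((EntryMeasurable.const _).mul h2).mul h1.rightInv).frobSq.ennreal_ofReal

end Frobenius

/-! Spectral norm estimates -/

section OperatorNorm

open scoped Matrix.Norms.L2Operator

variable {ι κ σ : Type*} [Fintype ι] [Fintype κ] [Fintype σ]

theorem dotProduct_self_nonneg_real (x : ι → ℝ) : 0 ≤ x ⬝ᵥ x :=
  Finset.sum_nonneg fun _ _ => mul_self_nonneg _

theorem dotProduct_gram_mulVec (M : Matrix κ ι ℝ) (x : ι → ℝ) :
    x ⬝ᵥ ((Mᵀ * M) *ᵥ x) = (M *ᵥ x) ⬝ᵥ (M *ᵥ x) := by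
  rw [← Matrix.mulVec_mulVec, Matrix.dotProduct_mulVec, Matrix.vecMul_transpose]

theorem dotProduct_mulVec_self_le_frobSq (M : Matrix ι κ ℝ) (x : κ → ℝ) :
    (M *ᵥ x) ⬝ᵥ (M *ᵥ x) ≤ frobSq M * (x ⬝ᵥ x) := by
  rw [frobSq, Finset.sum_mul]
  refine Finset.sum_le_sum fun i _ => ?_
  rw [← sq]
  refine (Finset.sum_mul_sq_le_sq_mul_sq _ _ _).trans (le_of_eq ?_)
  simp [dotProduct, sq]

/-- Here `β, c, d, t` stand for the norms of `Bx, Cx, Dx, x`, while `Λ = √λ₁` and `F, D` are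
Frobenius norms. Two features matter: the bound is affine in `D ^ 2`, so a second moment suffices,
and no separate `F ^ 2` term appears, because `β` and `c` share the budget `(Λ * t) ^ 2`. -/
theorem two_mul_add_abs_sq_sub_sq_le {β c d t Λ F D : ℝ} (hc : 0 ≤ c) (hd : 0 ≤ d)
    (ht : 0 ≤ t) (hΛ : 0 ≤ Λ) (hF : 0 < F) (hβc : β ^ 2 + c ^ 2 ≤ (Λ * t) ^ 2)
    (hcF : c ≤ F * t) (hdD : d ≤ D * t) :
    2 * β * d + |d ^ 2 - c ^ 2| ≤ (Λ * (F + D ^ 2 / F) + D ^ 2) * t ^ 2 := by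
  have hΛt : 0 ≤ Λ * t := mul_nonneg hΛ ht
  rcases le_or_gt d c with hdc | hdc
  · rw [abs_of_nonpos (by nlinarith)]
    rcases hc.eq_or_lt with rfl | hc
    · have : d = 0 := le_antisymm hdc hd
      subst this
      simp only [mul_zero, ne_eq, OfNat.ofNat_ne_zero, not_false_eq_true, zero_pow, sub_zero,
        neg_zero, add_zero]
      positivity
    -- Cauchy–Schwarz for `(β, c)` against `(2dc, c² - d²)`, a vector of length exactly `c² + d²`.
    · have hcs : (2 * β * d + (c ^ 2 - d ^ 2)) * c ≤ Λ * t * (c ^ 2 + d ^ 2) := by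
        refine abs_le_of_sq_le_sq' ?_ (by positivity) |>.2
        calc ((2 * β * d + (c ^ 2 - d ^ 2)) * c) ^ 2
            ≤ (β ^ 2 + c ^ 2) * (c ^ 2 + d ^ 2) ^ 2 := by
              nlinarith [sq_nonneg (β * (c ^ 2 - d ^ 2) - c * (2 * d * c))]
          _ ≤ (Λ * t) ^ 2 * (c ^ 2 + d ^ 2) ^ 2 := by gcongr
          _ = _ := by ring
      have htpos : 0 < t := by
        by_contra h
        have : t = 0 := le_antisymm (not_lt.1 h) ht
        rw [this, mul_zero] at hcF
        linarith
      have h1 : 2 * β * d + (c ^ 2 - d ^ 2) ≤ Λ * t * (c + d ^ 2 / c) := by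
        have : Λ * t * (c + d ^ 2 / c) = Λ * t * (c ^ 2 + d ^ 2) / c := by field_simp
        rw [this, le_div_iff₀ hc]
        exact hcs
      -- The function `c ↦ c + d²/c` increases for `c ≥ d`, so `c` may be raised to `F * t`.
      have h2 : c + d ^ 2 / c ≤ F * t + d ^ 2 / (F * t) := by
        have hFt : 0 < F * t := by positivity
        have : F * t + d ^ 2 / (F * t) - (c + d ^ 2 / c) =
            (F * t - c) * (F * t * c - d ^ 2) / (F * t * c) := by field_simp; ring
        have h3 : d ^ 2 ≤ F * t * c := by nlinarith
        have : 0 ≤ F * t + d ^ 2 / (F * t) - (c + d ^ 2 / c) := by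
          rw [this]
          exact div_nonneg (mul_nonneg (by linarith) (by linarith)) (by positivity)
        linarith
      have h3 : d ^ 2 / (F * t) ≤ D ^ 2 * t / F := by
        rw [div_le_div_iff₀ (by positivity) hF]
        have : d ^ 2 ≤ (D * t) ^ 2 := by gcongr
        nlinarith
      calc 2 * β * d + -(d ^ 2 - c ^ 2) ≤ Λ * t * (F * t + D ^ 2 * t / F) := by
            have := mul_le_mul_of_nonneg_left (h2.trans (add_le_add_right h3 _)) hΛt
            linarith
        _ = Λ * (F + D ^ 2 / F) * t ^ 2 := by field_simp
        _ ≤ _ := by nlinarith [mul_nonneg (sq_nonneg D) (sq_nonneg t)]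
  · rw [abs_of_nonneg (by nlinarith)]
    have hβ' : β ≤ Λ * t := by
      refine abs_le_of_sq_le_sq' ?_ hΛt |>.2
      nlinarith
    have h1 : 2 * D ≤ F + D ^ 2 / F := by
      have : F + D ^ 2 / F - 2 * D = (F - D) ^ 2 / F := by field_simp; ring
      have h2 : 0 ≤ (F - D) ^ 2 / F := by positivity
      linarith
    have h2 : d ^ 2 ≤ (D * t) ^ 2 := by gcongr
    have h3 : β * d ≤ Λ * t * (D * t) := mul_le_mul hβ' hdD hd hΛt
    have h4 := mul_le_mul_of_nonneg_left h1 (mul_nonneg hΛ (sq_nonneg t))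
    nlinarith [sq_nonneg c]

variable [DecidableEq ι]

theorem opNorm_le_of_abs_dotProduct_le (S : Matrix ι ι ℝ) (hS : Sᵀ = S) {K : ℝ} (hK : 0 ≤ K)
    (h : ∀ x, |x ⬝ᵥ (S *ᵥ x)| ≤ K * (x ⬝ᵥ x)) : ‖S‖ ≤ K := by
  rw [Matrix.cstar_norm_def]
  have hsymm : (Matrix.toEuclideanCLM (n := ι) (𝕜 := ℝ) S).toLinearMap.IsSymmetric := by
    intro x y
    change inner ℝ (Matrix.toEuclideanCLM (n := ι) (𝕜 := ℝ) S x) y =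
      inner ℝ x (Matrix.toEuclideanCLM (n := ι) (𝕜 := ℝ) S y)
    rw [real_inner_comm, Matrix.inner_toEuclideanCLM, Matrix.inner_toEuclideanCLM,
      Matrix.dotProduct_mulVec, ← Matrix.mulVec_transpose, hS, dotProduct_comm]
  rw [ContinuousLinearMap.norm_eq_iSup_rayleighQuotient _ hsymm]
  refine ciSup_le fun x => ?_
  rw [ContinuousLinearMap.rayleighQuotient, abs_div, abs_of_nonneg (sq_nonneg ‖x‖)]
  refine div_le_of_le_mul₀ (sq_nonneg _) hK ?_
  have h1 := h x.ofLp
  have h2 : x.ofLp ⬝ᵥ x.ofLp = ‖x‖ ^ 2 := by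
    rw [EuclideanSpace.real_norm_sq_eq]
    simp [dotProduct, sq]
  have h3 : (Matrix.toEuclideanCLM (n := ι) (𝕜 := ℝ) S).reApplyInnerSelf x =
      x.ofLp ⬝ᵥ (S *ᵥ x.ofLp) := by
    rw [ContinuousLinearMap.reApplyInnerSelf_apply, real_inner_comm, Matrix.inner_toEuclideanCLM]
    rfl
  rw [h3, ← h2]
  exact h1

/-- The difference is symmetric, so its quadratic form `2⟨Bx, Dx⟩ + |Dx|² - |Cx|²` determines its
norm. The hypothesis `hCD` covers `C = 0`, where the quotient takes the default value 0. -/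
theorem opNorm_gram_add_sub_gram_le (B D : Matrix κ ι ℝ) (C : Matrix σ ι ℝ) {lam : ℝ}
    (hlam : 0 ≤ lam) (hB : ∀ x, x ⬝ᵥ ((Bᵀ * B + Cᵀ * C) *ᵥ x) ≤ lam * (x ⬝ᵥ x))
    (hCD : frobSq C = 0 → frobSq D = 0) :
    ‖(B + D)ᵀ * (B + D) - (Bᵀ * B + Cᵀ * C)‖ ≤
      Real.sqrt lam * (Real.sqrt (frobSq C) + frobSq D / Real.sqrt (frobSq C)) + frobSq D := by
  have hK : 0 ≤ Real.sqrt lam * (Real.sqrt (frobSq C) + frobSq D / Real.sqrt (frobSq C)) +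
      frobSq D := by
    have := frobSq_nonneg D
    positivity
  refine opNorm_le_of_abs_dotProduct_le _ ?_ hK fun x => ?_
  · simp [Matrix.transpose_sub, Matrix.transpose_add, Matrix.transpose_mul]
  set b := B *ᵥ x
  set c := C *ᵥ x
  set d := D *ᵥ x
  have hval : x ⬝ᵥ (((B + D)ᵀ * (B + D) - (Bᵀ * B + Cᵀ * C)) *ᵥ x) =
      2 * (b ⬝ᵥ d) + (d ⬝ᵥ d - c ⬝ᵥ c) := by
    rw [Matrix.sub_mulVec, dotProduct_sub, Matrix.add_mulVec, dotProduct_add,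
      dotProduct_gram_mulVec, dotProduct_gram_mulVec B,
      dotProduct_gram_mulVec C, Matrix.add_mulVec, add_dotProduct, dotProduct_add, dotProduct_add,
      dotProduct_comm d b]
    ring
  have hbd : |b ⬝ᵥ d| ≤ Real.sqrt (b ⬝ᵥ b) * Real.sqrt (d ⬝ᵥ d) := by
    rw [← Real.sqrt_mul (dotProduct_self_nonneg_real b)]
    refine Real.abs_le_sqrt ?_
    refine (Finset.sum_mul_sq_le_sq_mul_sq _ _ _).trans (le_of_eq ?_)
    simp [dotProduct, sq]
  have hc2 := dotProduct_mulVec_self_le_frobSq C x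
  have hd2 := dotProduct_mulVec_self_le_frobSq D x
  have hbc := hB x
  rw [Matrix.add_mulVec, dotProduct_add, dotProduct_gram_mulVec, dotProduct_gram_mulVec C] at hbc
  rw [hval]
  rcases (frobSq_nonneg C).eq_or_lt with hC0 | hCpos
  · have hD0 := hCD hC0.symm
    have hc0 : c ⬝ᵥ c = 0 := le_antisymm (by simpa [← hC0] using hc2)
      (dotProduct_self_nonneg_real c)
    have hd0 : d ⬝ᵥ d = 0 := le_antisymm (by simpa [hD0] using hd2)
      (dotProduct_self_nonneg_real d)
    have hb0 : b ⬝ᵥ d = 0 := by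
      rw [hd0, Real.sqrt_zero, mul_zero] at hbd
      exact abs_nonpos_iff.1 hbd
    rw [hb0, hc0, hd0]
    simpa using mul_nonneg hK (dotProduct_self_nonneg_real x)
  have key := two_mul_add_abs_sq_sub_sq_le (β := Real.sqrt (b ⬝ᵥ b)) (Real.sqrt_nonneg (c ⬝ᵥ c))
    (Real.sqrt_nonneg (d ⬝ᵥ d)) (Real.sqrt_nonneg (x ⬝ᵥ x)) (Real.sqrt_nonneg lam)
    (Real.sqrt_pos.2 hCpos) (D := Real.sqrt (frobSq D))
    (by
      rw [mul_pow, Real.sq_sqrt (dotProduct_self_nonneg_real b),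
        Real.sq_sqrt (dotProduct_self_nonneg_real c), Real.sq_sqrt hlam,
        Real.sq_sqrt (dotProduct_self_nonneg_real x)]
      exact hbc)
    (by rw [← Real.sqrt_mul hCpos.le]; exact Real.sqrt_le_sqrt hc2)
    (by rw [← Real.sqrt_mul (frobSq_nonneg D)]; exact Real.sqrt_le_sqrt hd2)
  rw [Real.sq_sqrt (dotProduct_self_nonneg_real c),
    Real.sq_sqrt (dotProduct_self_nonneg_real d), Real.sq_sqrt (dotProduct_self_nonneg_real x),
    Real.sq_sqrt (frobSq_nonneg D)] at key
  refine (abs_add_le _ _).trans (le_trans (add_le_add_left ?_ _) key)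
  rw [abs_mul, abs_two, mul_assoc]
  linarith

end OperatorNorm

/-! Perturbation of the Gauss-Newton system -/

section Perturbation

open scoped Matrix.Norms.L2Operator

variable {n : ℕ}

theorem msqrt_posSemidef (M : Matrix (Fin n) (Fin n) ℝ) : (msqrt M).PosSemidef := by
  open scoped MatrixOrder in
  exact Matrix.nonneg_iff_posSemidef.1 (CFC.sqrt_nonneg M)

theorem msqrt_transpose (M : Matrix (Fin n) (Fin n) ℝ) : (msqrt M)ᵀ = msqrt M := by
  simpa using (msqrt_posSemidef M).isHermitian.eq

theorem msqrt_mul_self {M : Matrix (Fin n) (Fin n) ℝ} (hM : M.PosSemidef) :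
    msqrt M * msqrt M = M := by
  open scoped MatrixOrder in
  exact CFC.sqrt_mul_sqrt_self M (Matrix.nonneg_iff_posSemidef.2 hM)

theorem isUnit_det_msqrt {M : Matrix (Fin n) (Fin n) ℝ} (hM : M.PosDef) :
    IsUnit (msqrt M).det := by
  have h : (msqrt M).det * (msqrt M).det = M.det := by
    rw [← Matrix.det_mul, msqrt_mul_self hM.posSemidef]
  rw [isUnit_iff_ne_zero]
  intro h0
  rw [h0, zero_mul] at h
  exact hM.det_pos.ne h

theorem msqrt_inv {M : Matrix (Fin n) (Fin n) ℝ} (hM : M.PosDef) : msqrt M⁻¹ = (msqrt M)⁻¹ := by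
  have h1 : (msqrt M)⁻¹ * (msqrt M)⁻¹ = M⁻¹ := by
    rw [← Matrix.mul_inv_rev, msqrt_mul_self hM.posSemidef]
  open scoped MatrixOrder in
  exact CFC.sqrt_unique h1 (Matrix.nonneg_iff_posSemidef.2 (msqrt_posSemidef M).inv)

theorem posDef_one_add {P : Matrix (Fin n) (Fin n) ℝ} (hP : P.PosSemidef) : (1 + P).PosDef :=
  Matrix.PosDef.one.add_posSemidef hP

theorem norm2_sq (x : Fin n → ℝ) : norm2 x ^ 2 = x ⬝ᵥ x := by
  rw [norm2, EuclideanSpace.real_norm_sq_eq]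
  simp [dotProduct, sq]

theorem norm2_nonneg (x : Fin n → ℝ) : 0 ≤ norm2 x := norm_nonneg _

theorem norm2_mulVec_le (M : Matrix (Fin n) (Fin n) ℝ) (x : Fin n → ℝ) :
    norm2 (M *ᵥ x) ≤ ‖M‖ * norm2 x := by
  exact Matrix.l2_opNorm_mulVec M (WithLp.toLp 2 x)

theorem abs_dotProduct_le_norm2 (x y : Fin n → ℝ) : |x ⬝ᵥ y| ≤ norm2 x * norm2 y := by
  refine abs_le_of_sq_le_sq ?_ (mul_nonneg (norm2_nonneg x) (norm2_nonneg y))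
  rw [mul_pow, norm2_sq, norm2_sq]
  refine (Finset.sum_mul_sq_le_sq_mul_sq _ _ _).trans (le_of_eq ?_)
  simp [dotProduct, sq]

/-- For `y = (1 + P)⁻¹ z`, positivity gives `|y|² ≤ ⟨y, (1 + P) y⟩ = ⟨y, z⟩`. -/
theorem norm_inv_one_add_le {P : Matrix (Fin n) (Fin n) ℝ} (hP : P.PosSemidef) :
    ‖(1 + P)⁻¹‖ ≤ 1 := by
  rw [Matrix.l2_opNorm_def]
  refine ContinuousLinearMap.opNorm_le_bound _ zero_le_one fun z => ?_
  set y := (1 + P)⁻¹ *ᵥ z.ofLp with hy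
  have hz : (1 + P) *ᵥ y = z.ofLp := by
    rw [hy, Matrix.mulVec_mulVec, Matrix.mul_nonsing_inv _ (posDef_one_add hP).det_pos.ne'.isUnit,
      Matrix.one_mulVec]
  have h1 : y ⬝ᵥ y ≤ y ⬝ᵥ z.ofLp := by
    rw [← hz, Matrix.add_mulVec, Matrix.one_mulVec, dotProduct_add]
    have := hP.dotProduct_mulVec_nonneg y
    simp only [star_trivial] at this
    linarith
  have h2 := (le_abs_self _).trans (abs_dotProduct_le_norm2 y z.ofLp)
  rw [← norm2_sq] at h1
  have h3 : norm2 y ≤ norm2 z.ofLp := by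
    rcases (norm2_nonneg y).eq_or_lt with h0 | h0
    · rw [← h0]; exact norm2_nonneg _
    · nlinarith
  rw [one_mul]
  exact h3

/-- The weight `Γ^{-1/2}` cancels the outer factor of the inverse Gauss–Newton matrix, leaving only
the vector `Γ^{1/2} g`. -/
theorem relStepError_eq {Γ H : Matrix (Fin n) (Fin n) ℝ} (hΓ : Γ.PosDef)
    (H' : Matrix (Fin n) (Fin n) ℝ) (g : Fin n → ℝ) :
    relStepError Γ H H' g =
      norm2 ((1 + H')⁻¹ *ᵥ (msqrt Γ *ᵥ g) - (1 + H)⁻¹ *ᵥ (msqrt Γ *ᵥ g)) /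
        norm2 ((1 + H)⁻¹ *ᵥ (msqrt Γ *ᵥ g)) := by
  have hu := isUnit_det_msqrt hΓ
  have hstep : ∀ K : Matrix (Fin n) (Fin n) ℝ,
      msqrt Γ⁻¹ *ᵥ gnStep Γ K g = -((1 + K)⁻¹ *ᵥ (msqrt Γ *ᵥ g)) := by
    intro K
    have : (gnMatrix Γ K)⁻¹ = msqrt Γ * (1 + K)⁻¹ * msqrt Γ := by
      rw [gnMatrix, Matrix.mul_inv_rev, Matrix.mul_inv_rev, Matrix.nonsing_inv_nonsing_inv _ hu,
        Matrix.mul_assoc]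
    rw [gnStep, this, msqrt_inv hΓ, Matrix.mulVec_neg, Matrix.mulVec_mulVec, Matrix.mulVec_mulVec,
      ← Matrix.mul_assoc, ← Matrix.mul_assoc, Matrix.nonsing_inv_mul _ hu, Matrix.one_mul]
  have hneg : ∀ x : Fin n → ℝ, norm2 (-x) = norm2 x := fun x => by
    rw [norm2, norm2, WithLp.toLp_neg, norm_neg]
  rw [relStepError, weightedNorm, weightedNorm, Matrix.mulVec_sub, hstep, hstep, hneg]
  congr 2
  abel

theorem relStepError_nonneg (Γ H H' : Matrix (Fin n) (Fin n) ℝ) (g : Fin n → ℝ) :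
    0 ≤ relStepError Γ H H' g := div_nonneg (norm2_nonneg _) (norm2_nonneg _)

/-- With `u = (1 + H)⁻¹ h`, the error is `-(1 + H')⁻¹ (H' - H) u`, and the resolvent is a
contraction. -/
theorem relStepError_le {Γ H H' : Matrix (Fin n) (Fin n) ℝ} (hΓ : Γ.PosDef)
    (hH : H.PosSemidef) (hH' : H'.PosSemidef) (g : Fin n → ℝ) :
    relStepError Γ H H' g ≤ ‖H' - H‖ := by
  rw [relStepError_eq hΓ]
  refine div_le_of_le_mul₀ (norm2_nonneg _) (norm_nonneg _) ?_
  set h := msqrt Γ *ᵥ g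
  set u := (1 + H)⁻¹ *ᵥ h with hu
  have hh : h = (1 + H) *ᵥ u := by
    rw [hu, Matrix.mulVec_mulVec, Matrix.mul_nonsing_inv _ (posDef_one_add hH).det_pos.ne'.isUnit,
      Matrix.one_mulVec]
  have hu' : u = (1 + H')⁻¹ *ᵥ ((1 + H') *ᵥ u) := by
    rw [Matrix.mulVec_mulVec, Matrix.nonsing_inv_mul _ (posDef_one_add hH').det_pos.ne'.isUnit,
      Matrix.one_mulVec]
  have hdiff : (1 + H')⁻¹ *ᵥ h - u = (1 + H')⁻¹ *ᵥ (-((H' - H) *ᵥ u)) := by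
    calc (1 + H')⁻¹ *ᵥ h - u
        = (1 + H')⁻¹ *ᵥ ((1 + H) *ᵥ u) - (1 + H')⁻¹ *ᵥ ((1 + H') *ᵥ u) := by rw [← hu', ← hh]
      _ = _ := by
        rw [← Matrix.mulVec_sub, ← Matrix.sub_mulVec, ← Matrix.neg_mulVec]
        congr 2
        abel
  have hneg : ∀ x : Fin n → ℝ, norm2 (-x) = norm2 x := fun x => by
    rw [norm2, norm2, WithLp.toLp_neg, norm_neg]
  rw [hdiff]
  calc norm2 ((1 + H')⁻¹ *ᵥ (-((H' - H) *ᵥ u)))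
      ≤ ‖(1 + H')⁻¹‖ * norm2 (-((H' - H) *ᵥ u)) := norm2_mulVec_le _ _
    _ ≤ 1 * (‖H' - H‖ * norm2 u) := by
        rw [hneg]
        exact mul_le_mul (norm_inv_one_add_le hH') (norm2_mulVec_le _ _) (norm2_nonneg _)
          zero_le_one
    _ = _ := one_mul _

theorem norm_mul_transpose_self (X : Matrix (Fin n) (Fin n) ℝ) : ‖X * Xᵀ‖ = ‖Xᵀ * X‖ := by
  have h1 := Matrix.l2_opNorm_conjTranspose_mul_self X
  have h2 := Matrix.l2_opNorm_conjTranspose_mul_self Xᵀ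
  have h3 := Matrix.l2_opNorm_conjTranspose X
  simp only [Matrix.conjTranspose_eq_transpose_of_trivial, Matrix.transpose_transpose] at h1 h2 h3
  rw [h1, h2, h3]

/-- Both sides have the forms `XXᵀ` and `XᵀX` with `X = P^{1/2} R^{-1/2}`. -/
theorem norm_msqrt_mul_inv_mul_msqrt {P R : Matrix (Fin n) (Fin n) ℝ} (hP : P.PosDef)
    (hR : R.PosDef) :
    ‖msqrt P * R⁻¹ * msqrt P‖ = ‖(msqrt R)⁻¹ * P * (msqrt R)⁻¹‖ := by
  have h := norm_mul_transpose_self (msqrt P * (msqrt R)⁻¹)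
  rw [Matrix.transpose_mul, Matrix.transpose_nonsing_inv, msqrt_transpose, msqrt_transpose] at h
  have h1 : msqrt P * (msqrt R)⁻¹ * ((msqrt R)⁻¹ * msqrt P) = msqrt P * R⁻¹ * msqrt P := by
    rw [← Matrix.mul_assoc, Matrix.mul_assoc (msqrt P), ← Matrix.mul_inv_rev,
      msqrt_mul_self hR.posSemidef]
  have h2 : (msqrt R)⁻¹ * msqrt P * (msqrt P * (msqrt R)⁻¹) =
      (msqrt R)⁻¹ * P * (msqrt R)⁻¹ := by
    rw [Matrix.mul_assoc, ← Matrix.mul_assoc (msqrt P), msqrt_mul_self hP.posSemidef,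
      ← Matrix.mul_assoc]
  rwa [h1, h2] at h

/-- Whitening by `s = (1 + H')^{-1/2}` turns `1 + H` into `1 - s (H' - H) s`, and `‖s‖² = ‖(1 +
H')⁻¹‖ ≤ 1`. -/
theorem norm_whitened_le {H H' : Matrix (Fin n) (Fin n) ℝ} (hH' : H'.PosSemidef) :
    ‖(msqrt (1 + H'))⁻¹ * (1 + H) * (msqrt (1 + H'))⁻¹‖ ≤ 1 + ‖H' - H‖ := by
  set s := (msqrt (1 + H'))⁻¹ with hs
  have hP := posDef_one_add hH'
  have hu := isUnit_det_msqrt hP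
  have hst : sᵀ = s := by rw [hs, Matrix.transpose_nonsing_inv, msqrt_transpose]
  have hone : s * (1 + H') * s = 1 := by
    have h1 : s * (1 + H') * s = s * (msqrt (1 + H') * msqrt (1 + H')) * s := by
      rw [msqrt_mul_self hP.posSemidef]
    rw [h1, ← Matrix.mul_assoc, hs, Matrix.nonsing_inv_mul _ hu, Matrix.one_mul,
      Matrix.mul_nonsing_inv _ hu]
  have hsn : ‖s‖ * ‖s‖ ≤ 1 := by
    have h1 := Matrix.l2_opNorm_conjTranspose_mul_self s
    rw [Matrix.conjTranspose_eq_transpose_of_trivial, hst] at h1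
    rw [← h1, hs, ← Matrix.mul_inv_rev, msqrt_mul_self hP.posSemidef]
    exact norm_inv_one_add_le hH'
  have hI : ‖(1 : Matrix (Fin n) (Fin n) ℝ)‖ ≤ 1 := by
    have := norm_inv_one_add_le (Matrix.PosSemidef.zero (n := Fin n) (R := ℝ))
    simpa using this
  have hsplit : s * (1 + H) * s = 1 - s * (H' - H) * s := by
    have h1 : s * (1 + H) * s = s * (1 + H') * s - s * (H' - H) * s := by
      rw [← Matrix.sub_mul, ← Matrix.mul_sub]
      congr 2
      abel
    rw [h1, hone]
  rw [hsplit]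
  refine (norm_sub_le _ _).trans (add_le_add hI ?_)
  calc ‖s * (H' - H) * s‖ ≤ ‖s‖ * ‖H' - H‖ * ‖s‖ :=
        (norm_mul_le _ _).trans (mul_le_mul_of_nonneg_right (norm_mul_le _ _) (norm_nonneg _))
    _ = (‖s‖ * ‖s‖) * ‖H' - H‖ := by ring
    _ ≤ 1 * ‖H' - H‖ := mul_le_mul_of_nonneg_right hsn (norm_nonneg _)
    _ = _ := one_mul _

/-- Only the square root of the fixed matrix `1 + H` remains, so the expression is visibly
measurable in `H'`. -/
theorem cond2_precond_eq {H H' : Matrix (Fin n) (Fin n) ℝ} (hH : H.PosSemidef)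
    (hH' : H'.PosSemidef) :
    cond2 (precond H H') = ‖msqrt (1 + H) * (1 + H')⁻¹ * msqrt (1 + H)‖ *
      ‖(msqrt (1 + H))⁻¹ * (1 + H') * (msqrt (1 + H))⁻¹‖ := by
  have hP := posDef_one_add hH
  have hP' := posDef_one_add hH'
  have hinv : (precond H H')⁻¹ = msqrt (1 + H') * (1 + H)⁻¹ * msqrt (1 + H') := by
    rw [precond, Matrix.mul_inv_rev, Matrix.mul_inv_rev,
      Matrix.nonsing_inv_nonsing_inv _ (isUnit_det_msqrt hP'), Matrix.mul_assoc]
  rw [cond2, hinv, norm_msqrt_mul_inv_mul_msqrt hP' hP, norm_msqrt_mul_inv_mul_msqrt hP hP',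
    precond]

theorem sqrt_cond2_precond_le {H H' : Matrix (Fin n) (Fin n) ℝ} (hH : H.PosSemidef)
    (hH' : H'.PosSemidef) : Real.sqrt (cond2 (precond H H')) ≤ 1 + ‖H' - H‖ := by
  rw [cond2_precond_eq hH hH', norm_msqrt_mul_inv_mul_msqrt (posDef_one_add hH)
    (posDef_one_add hH')]
  have h1 := norm_whitened_le (H := H) hH'
  have h2 := norm_whitened_le (H := H') hH
  rw [norm_sub_rev] at h2
  refine Real.sqrt_le_iff.2 ⟨by positivity, ?_⟩
  rw [sq]
  exact mul_le_mul h1 h2 (norm_nonneg _) (by positivity)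

variable {α : Type*} [MeasurableSpace α]

theorem EntryMeasurable.norm {M : α → Matrix (Fin n) (Fin n) ℝ} (hM : EntryMeasurable M) :
    Measurable fun x => ‖M x‖ := by
  have hc : Continuous fun f : Fin n → Fin n → ℝ => ‖(Matrix.of f : Matrix (Fin n) (Fin n) ℝ)‖ :=
    continuous_norm.comp continuous_id
  exact hc.measurable.comp (measurable_pi_lambda _ fun i => measurable_pi_lambda _ fun j => hM i j)

theorem EntryMeasurable.sqrt_cond2_precond {H : Matrix (Fin n) (Fin n) ℝ} (hH : H.PosSemidef)
    {M : α → Matrix (Fin n) (Fin n) ℝ} (hM : EntryMeasurable M) (hpsd : ∀ x, (M x).PosSemidef) :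
    Measurable fun x => Real.sqrt (cond2 (precond H (M x))) := by
  simp_rw [fun x => cond2_precond_eq hH (hpsd x)]
  have h1 := (const 1).add hM
  exact ((((const (msqrt (1 + H))).mul h1.inv).mul (const (msqrt (1 + H)))).norm.mul
    (((const (msqrt (1 + H))⁻¹).mul h1).mul (const (msqrt (1 + H))⁻¹)).norm).sqrt

theorem EntryMeasurable.relStepError {Γ H : Matrix (Fin n) (Fin n) ℝ} (hΓ : Γ.PosDef)
    {M : α → Matrix (Fin n) (Fin n) ℝ} (hM : EntryMeasurable M) (g : Fin n → ℝ) :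
    Measurable fun x => relStepError Γ H (M x) g := by
  simp_rw [relStepError_eq hΓ]
  have h1 := ((const 1).add hM).inv
  refine Measurable.div_const ?_ _
  have hn : Measurable (norm2 : (Fin n → ℝ) → ℝ) := by
    unfold norm2
    exact Measurable.norm (by fun_prop)
  refine hn.comp (measurable_pi_lambda _ fun i => ?_)
  refine Measurable.sub_const ?_ _
  have hsum : Measurable fun x => ∑ j, (1 + M x)⁻¹ i j * (msqrt Γ *ᵥ g) j :=
    Finset.measurable_sum _ fun j _ => (h1 i j).mul_const _
  exact hsum

end Perturbation

/-! Spectral decomposition of the misfit Hessian -/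

section Spectral

variable {m n : ℕ}

theorem misfitHessian_posSemidef (A : Matrix (Fin m) (Fin n) ℝ) :
    (misfitHessian A).PosSemidef := by
  simpa [misfitHessian] using Matrix.posSemidef_conjTranspose_mul_self A

theorem exists_misfitHessian_diagonalization (A : Matrix (Fin m) (Fin n) ℝ) :
    ∃ U : Matrix (Fin n) (Fin n) ℝ, Uᵀ * U = 1 ∧ U * Uᵀ = 1 ∧
      Uᵀ * misfitHessian A * U = Matrix.diagonal fun j : Fin n => misfitEig A j := by
  set hA := misfitHessian_isHermitian A
  set b := hA.eigenvectorBasis with hb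
  -- This undoes the reindexing between `eigenvalues` and the sorted `eigenvalues₀`, so that column
  -- `j` of `U` belongs to the eigenvalue in position `j` of the nonincreasing order.
  set e : Fin n ≃ Fin n := (finCongr (Fintype.card_fin n).symm).trans
    (Fintype.equivOfCardEq (Fintype.card_fin (Fintype.card (Fin n)))) with he
  set U : Matrix (Fin n) (Fin n) ℝ := Matrix.of fun i j => b (e j) i with hU
  have heig : ∀ j : Fin n, hA.eigenvalues (e j) = misfitEig A j := by
    intro j
    rw [misfitEig, dif_pos j.2, Matrix.IsHermitian.eigenvalues]
    congr 1
    simp [he]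
    rfl
  have hUU : Uᵀ * U = 1 := by
    ext a c
    have := orthonormal_iff_ite.1 b.orthonormal (e a) (e c)
    rw [PiLp.inner_apply] at this
    simp only [e.apply_eq_iff_eq] at this
    rw [Matrix.mul_apply, Matrix.one_apply, ← this]
    exact Finset.sum_congr rfl fun i _ => by simp [hU, mul_comm]
  have hHU : misfitHessian A * U = U * Matrix.diagonal fun j : Fin n => misfitEig A j := by
    ext i j
    have := congrFun (hA.mulVec_eigenvectorBasis (e j)) i
    rw [Matrix.mul_diagonal, ← heig]
    simpa [Matrix.mul_apply, Matrix.mulVec, dotProduct, hU, mul_comm] using this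
  exact ⟨U, hUU, mul_eq_one_comm.1 hUU, by rw [Matrix.mul_assoc, hHU, ← Matrix.mul_assoc, hUU,
    Matrix.one_mul]⟩

theorem misfitEig_nonneg (A : Matrix (Fin m) (Fin n) ℝ) (j : ℕ) : 0 ≤ misfitEig A j := by
  rw [misfitEig]
  split_ifs with h
  · set e := Fintype.equivOfCardEq (Fintype.card_fin (Fintype.card (Fin n)))
    have := (misfitHessian_posSemidef A).eigenvalues_nonneg (e ⟨j, by simpa using h⟩)
    rw [Matrix.IsHermitian.eigenvalues] at this
    simpa [e] using this
  · exact le_rfl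

theorem misfitEig_le_zeroth (A : Matrix (Fin m) (Fin n) ℝ) (j : ℕ) :
    misfitEig A j ≤ misfitEig A 0 := by
  by_cases h : j < n
  · rw [misfitEig, misfitEig, dif_pos h, dif_pos (by omega)]
    exact (misfitHessian_isHermitian A).eigenvalues₀_antitone (Fin.mk_le_mk.2 (Nat.zero_le _))
  · rw [misfitEig, dif_neg h]
    exact misfitEig_nonneg A 0

theorem dotProduct_misfitHessian_mulVec_le (A : Matrix (Fin m) (Fin n) ℝ) (x : Fin n → ℝ) :
    x ⬝ᵥ (misfitHessian A *ᵥ x) ≤ misfitEig A 0 * (x ⬝ᵥ x) := by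
  obtain ⟨U, -, hU2, hD⟩ := exists_misfitHessian_diagonalization A
  set y := Uᵀ *ᵥ x with hy
  have hx : x = U *ᵥ y := by rw [hy, Matrix.mulVec_mulVec, hU2, Matrix.one_mulVec]
  have hyy : y ⬝ᵥ y = x ⬝ᵥ x := by
    rw [hy, Matrix.dotProduct_mulVec, Matrix.vecMul_transpose, Matrix.mulVec_mulVec, hU2,
      Matrix.one_mulVec]
  have hq : x ⬝ᵥ (misfitHessian A *ᵥ x) =
      y ⬝ᵥ (Matrix.diagonal (fun j : Fin n => misfitEig A j) *ᵥ y) := by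
    rw [← hD, ← Matrix.mulVec_mulVec, ← Matrix.mulVec_mulVec, ← hx, Matrix.dotProduct_mulVec _ Uᵀ,
      Matrix.vecMul_transpose, ← hx]
  rw [hq, ← hyy, dotProduct, dotProduct, Finset.mul_sum]
  refine Finset.sum_le_sum fun j _ => ?_
  rw [Matrix.mulVec_diagonal]
  nlinarith [mul_le_mul_of_nonneg_right (misfitEig_le_zeroth A j) (mul_self_nonneg (y j))]

/-- The sum of the eigenvalues beyond the first `r` is the squared Frobenius distance to `A` of
its compression to the span of the first `r` eigenvectors. -/
theorem exists_frobSq_tail (A : Matrix (Fin m) (Fin n) ℝ) {r : ℕ} (hr : r ≤ n) :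
    ∃ V : Matrix (Fin n) (Fin r) ℝ, Vᵀ * V = 1 ∧
      frobSq (A - A * V * Vᵀ) = ∑ j ∈ Finset.Ico r n, misfitEig A j := by
  obtain ⟨U, hU1, hU2, hD⟩ := exists_misfitHessian_diagonalization A
  set V : Matrix (Fin n) (Fin r) ℝ := U.submatrix id (Fin.castLE hr) with hV
  have hVU : ∀ a b, (Vᵀ * U) a b = if Fin.castLE hr a = b then 1 else 0 := by
    intro a b
    have := congrFun (congrFun hU1 (Fin.castLE hr a)) b
    rw [Matrix.one_apply] at this
    rw [← this]
    rfl
  have hVV : Vᵀ * V = 1 := by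
    ext a b
    have := hVU a (Fin.castLE hr b)
    simp only [Fin.castLE_inj] at this
    rw [Matrix.one_apply, ← this]
    rfl
  refine ⟨V, hVV, ?_⟩
  -- Multiplying by `U` preserves the Frobenius norm. It kills the first `r` columns, and column `j`
  -- of `A * U` has squared norm equal to the eigenvalue at `j`.
  have hcol : ∀ i j, ((A - A * V * Vᵀ) * U) i j = if (j : ℕ) < r then 0 else (A * U) i j := by
    intro i j
    rw [Matrix.sub_mul, Matrix.mul_assoc (A * V), Matrix.sub_apply, Matrix.mul_apply (M := A * V)]
    simp_rw [hVU]
    split_ifs with h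
    · have hj : ∀ x : Fin r, (Fin.castLE hr x = j) ↔ x = ⟨j, h⟩ := fun x => by
        constructor
        · intro hx; exact Fin.ext (by simpa using congrArg Fin.val hx)
        · rintro rfl; rfl
      simp_rw [hj]
      simp only [mul_ite, mul_one, mul_zero, Finset.sum_ite_eq', Finset.mem_univ, if_true]
      rw [sub_eq_zero]
      rfl
    · have hj : ∀ x : Fin r, Fin.castLE hr x ≠ j := fun x hx => h (by
        rw [← hx]; exact x.2)
      simp [hj]
  have hdiag : ∀ j : Fin n, ∑ i, (A * U) i j ^ 2 = misfitEig A j := by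
    intro j
    have := congrFun (congrFun hD j) j
    rw [Matrix.diagonal_apply_eq] at this
    rw [← this, misfitHessian, ← Matrix.mul_assoc, Matrix.mul_assoc, ← Matrix.transpose_mul,
      Matrix.mul_apply]
    exact Finset.sum_congr rfl fun i _ => by rw [Matrix.transpose_apply, sq]
  rw [← frobSq_mul_of_orthogonal _ U hU2, ← frobSq_transpose, frobSq]
  have hterm : ∀ j : Fin n, ∑ i, ((A - A * V * Vᵀ) * U)ᵀ j i ^ 2 =
      if r ≤ (j : ℕ) then misfitEig A j else 0 := by
    intro j
    simp_rw [Matrix.transpose_apply, hcol]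
    by_cases h : (j : ℕ) < r
    · simp [h]
    · simp only [h, if_false, hdiag, not_lt.1 h, if_true]
  rw [Finset.sum_congr rfl fun j _ => hterm j,
    Fin.sum_univ_eq_sum_range (fun j => if r ≤ j then misfitEig A j else 0) n,
    ← Finset.sum_filter]
  refine Finset.sum_congr ?_ fun _ _ => rfl
  ext j
  simp only [Finset.mem_filter, Finset.mem_range, Finset.mem_Ico]
  tauto

end Spectral

/-! The SingleView sketch -/

section Sketch

variable {m n : ℕ}

theorem frobSq_compl_projection_le {ι κ τ : Type*} [Fintype ι] [Fintype κ] [Fintype τ]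
    [DecidableEq ι] [DecidableEq κ] (Q : Matrix ι κ ℝ) (hQ : Qᵀ * Q = 1) (M : Matrix ι τ ℝ) :
    frobSq (M - Q * Qᵀ * M) ≤ frobSq M := by
  have h : frobSq M = frobSq (M - Q * Qᵀ * M) + frobSq (Qᵀ * M) := by
    simp only [← frobSq_transpose M, ← frobSq_transpose (M - Q * Qᵀ * M),
      ← frobSq_transpose (Qᵀ * M), frobSq_eq_trace, Matrix.transpose_transpose]
    rw [← Matrix.trace_add]
    congr 1
    have h1 : (Q * Qᵀ * M)ᵀ * (Q * Qᵀ * M) = (Qᵀ * M)ᵀ * (Qᵀ * M) := by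
      simp only [Matrix.transpose_mul, Matrix.transpose_transpose, Matrix.mul_assoc]
      rw [← Matrix.mul_assoc Qᵀ Q, hQ, Matrix.one_mul]
    have h2 : Mᵀ * (Q * Qᵀ * M) = (Qᵀ * M)ᵀ * (Qᵀ * M) := by
      simp only [Matrix.transpose_mul, Matrix.transpose_transpose, Matrix.mul_assoc]
    have h3 : (Q * Qᵀ * M)ᵀ * M = (Qᵀ * M)ᵀ * (Qᵀ * M) := by
      simp only [Matrix.transpose_mul, Matrix.transpose_transpose, Matrix.mul_assoc]
    rw [Matrix.transpose_sub, Matrix.sub_mul, Matrix.mul_sub, Matrix.mul_sub, h1, h2, h3]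
    abel
  rw [h]
  linarith [frobSq_nonneg (Qᵀ * M)]

theorem frobSq_add_of_mul_transpose_eq_zero {ι κ : Type*} [Fintype ι] [Fintype κ]
    (M N : Matrix ι κ ℝ) (h : M * Nᵀ = 0) : frobSq (M + N) = frobSq M + frobSq N := by
  have h' : N * Mᵀ = 0 := by
    rw [← Matrix.transpose_transpose (N * Mᵀ), Matrix.transpose_mul, Matrix.transpose_transpose, h,
      Matrix.transpose_zero]
  rw [frobSq_eq_trace, frobSq_eq_trace, frobSq_eq_trace, Matrix.transpose_add, Matrix.add_mul,
    Matrix.mul_add, Matrix.mul_add, h, h', add_zero, zero_add, Matrix.trace_add]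

/-- The error of the range finder is controlled by an oblique projection of the tail of `A`. -/
theorem frobSq_rangeFinder_le {l k r : ℕ} (A : Matrix (Fin m) (Fin n) ℝ)
    (Om : Matrix (Fin n) (Fin l) ℝ) (Q : Matrix (Fin m) (Fin k) ℝ) (R : Matrix (Fin k) (Fin l) ℝ)
    (hQ : Qᵀ * Q = 1) (hQR : A * Om = Q * R) (V : Matrix (Fin n) (Fin r) ℝ) (hV : Vᵀ * V = 1)
    (hdet : IsUnit ((Vᵀ * Om) * (Vᵀ * Om)ᵀ).det) :
    frobSq (A - Q * Qᵀ * A) ≤ frobSq (A - A * V * Vᵀ) +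
      frobSq ((A - A * V * Vᵀ) * Om * rightInv (Vᵀ * Om)) := by
  set E := A - A * V * Vᵀ with hE
  have hEV : E * V = 0 := by
    rw [hE, Matrix.sub_mul, Matrix.mul_assoc (A * V), hV, Matrix.mul_one, sub_self]
  have hinv : Vᵀ * Om * rightInv (Vᵀ * Om) = 1 := by
    rw [rightInv, ← Matrix.mul_assoc, Matrix.mul_nonsing_inv _ hdet]
  -- The left side is `A * Om * rightInv (Vᵀ * Om)`, hence lies in the range of `Q`; so `A * V` and
  -- `-G` have the same component off that range.
  have hAV : A * V + E * Om * rightInv (Vᵀ * Om) = Q * (R * rightInv (Vᵀ * Om)) := by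
    have hA : A = A * V * Vᵀ + E := by rw [hE]; abel
    calc A * V + E * Om * rightInv (Vᵀ * Om)
        = A * V * (Vᵀ * Om * rightInv (Vᵀ * Om)) + E * Om * rightInv (Vᵀ * Om) := by
          rw [hinv, Matrix.mul_one]
      _ = (A * V * Vᵀ + E) * Om * rightInv (Vᵀ * Om) := by
          simp only [Matrix.add_mul, Matrix.mul_assoc]
      _ = _ := by rw [← hA, hQR, Matrix.mul_assoc]
  set G := E * Om * rightInv (Vᵀ * Om)
  have hPAV : A * V - Q * Qᵀ * (A * V) = -(G - Q * Qᵀ * G) := by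
    have h1 : A * V = Q * (R * rightInv (Vᵀ * Om)) - G := by rw [← hAV]; abel
    have h2 : Q * Qᵀ * (Q * (R * rightInv (Vᵀ * Om))) = Q * (R * rightInv (Vᵀ * Om)) := by
      rw [Matrix.mul_assoc, ← Matrix.mul_assoc Qᵀ, hQ, Matrix.one_mul]
    rw [h1, Matrix.mul_sub, h2]
    abel
  have hsplit : A - Q * Qᵀ * A =
      (A * V - Q * Qᵀ * (A * V)) * Vᵀ + (E - Q * Qᵀ * E) := by
    rw [hE]
    simp only [Matrix.sub_mul, Matrix.mul_sub, Matrix.mul_assoc]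
    abel
  -- Since `E * V = 0`, the rows of the two pieces are orthogonal and their squared norms add up.
  have horth : (A * V - Q * Qᵀ * (A * V)) * Vᵀ * (E - Q * Qᵀ * E)ᵀ = 0 := by
    have : Vᵀ * Eᵀ = 0 := by rw [← Matrix.transpose_mul, hEV, Matrix.transpose_zero]
    rw [Matrix.transpose_sub, Matrix.transpose_mul (Q * Qᵀ), Matrix.mul_sub,
      ← Matrix.mul_assoc _ Eᵀ,
      Matrix.mul_assoc _ Vᵀ, this]
    simp
  have hneg : ∀ M : Matrix (Fin m) (Fin r) ℝ, frobSq (-M) = frobSq M := fun M => by simp [frobSq]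
  have hVF : ∀ M : Matrix (Fin m) (Fin r) ℝ, frobSq (M * Vᵀ) = frobSq M := fun M => by
    rw [frobSq_eq_trace, frobSq_eq_trace, Matrix.transpose_mul, Matrix.transpose_transpose,
      Matrix.mul_assoc, ← Matrix.mul_assoc Vᵀ, hV, Matrix.one_mul]
  rw [hsplit, frobSq_add_of_mul_transpose_eq_zero _ _ horth, hVF, hPAV, hneg, add_comm]
  exact add_le_add (frobSq_compl_projection_le Q hQ E) (frobSq_compl_projection_le Q hQ G)

/-- The core factor of the SingleView approximation with range basis `Q`. -/
def sketchCore {l k : ℕ} (A : Matrix (Fin m) (Fin n) ℝ) (Ps : Matrix (Fin m) (Fin l) ℝ)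
    (Q : Matrix (Fin m) (Fin k) ℝ) : Matrix (Fin k) (Fin n) ℝ :=
  ((Qᵀ * Ps) * (Qᵀ * Ps)ᵀ)⁻¹ * (Qᵀ * Ps) * (Psᵀ * A)

/-- When `QᵀΨ` has full row rank, `R_M†` solves the normal equations, and the product does not
depend on the chosen QR factors of `M` or on the SVD. Measurability is thus needed only for `Q_Y`.
-/
theorem singleViewOutput_eq {l₁ l₂ : ℕ} (A : Matrix (Fin m) (Fin n) ℝ)
    (qr : Matrix (Fin m) (Fin l₁) ℝ →
      Matrix (Fin m) (Fin (min m l₁)) ℝ × Matrix (Fin (min m l₁)) (Fin l₁) ℝ)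
    (Om : Matrix (Fin n) (Fin l₁) ℝ) (Ps : Matrix (Fin m) (Fin l₂) ℝ)
    (V : Matrix (Fin n) (Fin (min (min m l₁) n)) ℝ)
    (L : Matrix (Fin (min (min m l₁) n)) (Fin (min (min m l₁) n)) ℝ)
    (hout : IsSingleViewOutput A qr Om Ps V L)
    (hdet : IsUnit (((qr (A * Om)).1ᵀ * Ps) * ((qr (A * Om)).1ᵀ * Ps)ᵀ).det) :
    V * L * Vᵀ = (sketchCore A Ps (qr (A * Om)).1)ᵀ * sketchCore A Ps (qr (A * Om)).1 := by
  obtain ⟨QM, RM, X, U, s, ⟨hM, hQM, -⟩, ⟨hX1, -, hX3, -⟩, ⟨hW, hU, -, -, -⟩, hL⟩ := hout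
  set Q := (qr (A * Om)).1
  have hMt : Qᵀ * Ps = RMᵀ * QMᵀ := by
    rw [← Matrix.transpose_mul, ← hM, Matrix.transpose_mul, Matrix.transpose_transpose]
  have hN : (Qᵀ * Ps) * (Qᵀ * Ps)ᵀ = RMᵀ * RM := by
    rw [hMt, Matrix.transpose_mul, Matrix.transpose_transpose, Matrix.transpose_transpose,
      Matrix.mul_assoc, ← Matrix.mul_assoc QMᵀ, hQM, Matrix.one_mul]
  -- The first and third Penrose equations give the normal equations.
  have hNX : RMᵀ * RM * X = RMᵀ := by
    calc RMᵀ * RM * X = RMᵀ * (RM * X)ᵀ := by rw [hX3, Matrix.mul_assoc]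
      _ = (RM * X * RM)ᵀ := by rw [Matrix.transpose_mul (RM * X)]
      _ = RMᵀ := by rw [hX1]
  have hXeq : X = (RMᵀ * RM)⁻¹ * RMᵀ := by
    calc X = (RMᵀ * RM)⁻¹ * (RMᵀ * RM * X) := by
          rw [← Matrix.mul_assoc, Matrix.nonsing_inv_mul _ (hN ▸ hdet), Matrix.one_mul]
      _ = _ := by rw [hNX]
  have hcore : X * (Aᵀ * Ps * QM)ᵀ = sketchCore A Ps Q := by
    rw [sketchCore, hN, hXeq, hMt]
    simp only [Matrix.transpose_mul, Matrix.transpose_transpose, Matrix.mul_assoc]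
  rw [← hcore, hW, hL]
  simp only [Matrix.transpose_mul, Matrix.transpose_transpose, Matrix.diagonal_transpose, sq,
    Matrix.mul_assoc]
  rw [← Matrix.mul_assoc Uᵀ, hU, Matrix.one_mul]

/-- The core reproduces the part `QQᵀA` of `A` exactly and adds an oblique image `D` of the residual
`C`; as `QᵀC = 0`, `H` splits as `(QᵀA)ᵀ(QᵀA) + CᵀC`. -/
theorem norm_sketch_sub_le {l k : ℕ} (A : Matrix (Fin m) (Fin n) ℝ)
    (Ps : Matrix (Fin m) (Fin l) ℝ) (Q : Matrix (Fin m) (Fin k) ℝ) (hQ : Qᵀ * Q = 1)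
    (hdet : IsUnit ((Qᵀ * Ps) * (Qᵀ * Ps)ᵀ).det)
    (hCD : frobSq (A - Q * Qᵀ * A) = 0 →
      frobSq ((A - Q * Qᵀ * A)ᵀ * Ps * rightInv (Qᵀ * Ps)) = 0) :
    (open scoped Matrix.Norms.L2Operator in
      ‖(sketchCore A Ps Q)ᵀ * sketchCore A Ps Q - misfitHessian A‖) ≤
      Real.sqrt (misfitEig A 0) * (Real.sqrt (frobSq (A - Q * Qᵀ * A)) +
        frobSq ((A - Q * Qᵀ * A)ᵀ * Ps * rightInv (Qᵀ * Ps)) /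
          Real.sqrt (frobSq (A - Q * Qᵀ * A))) +
        frobSq ((A - Q * Qᵀ * A)ᵀ * Ps * rightInv (Qᵀ * Ps)) := by
  set C := A - Q * Qᵀ * A with hC
  set D := (Cᵀ * Ps * rightInv (Qᵀ * Ps))ᵀ with hD
  set N := (Qᵀ * Ps) * (Qᵀ * Ps)ᵀ with hN
  have hNT : Nᵀ = N := by rw [hN, Matrix.transpose_mul, Matrix.transpose_transpose]
  have hA : A = Q * (Qᵀ * A) + C := by rw [hC, ← Matrix.mul_assoc]; abel
  have hQC : Qᵀ * C = 0 := by
    rw [hC, Matrix.mul_sub, ← Matrix.mul_assoc, ← Matrix.mul_assoc, hQ, Matrix.one_mul, sub_self]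
  have hcore : sketchCore A Ps Q = Qᵀ * A + D := by
    have h1 : N⁻¹ * (Qᵀ * Ps) * (Psᵀ * (Q * (Qᵀ * A))) = Qᵀ * A := by
      have : N⁻¹ * (Qᵀ * Ps) * (Psᵀ * (Q * (Qᵀ * A))) = (N⁻¹ * N) * (Qᵀ * A) := by
        rw [hN]
        simp only [Matrix.transpose_mul, Matrix.transpose_transpose, Matrix.mul_assoc]
      rw [this, Matrix.nonsing_inv_mul _ hdet, Matrix.one_mul]
    have h2 : D = N⁻¹ * (Qᵀ * Ps) * (Psᵀ * C) := by
      rw [hD, rightInv, ← hN]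
      simp only [Matrix.transpose_mul, Matrix.transpose_transpose, Matrix.transpose_nonsing_inv,
        hNT, Matrix.mul_assoc]
    rw [sketchCore, ← hN]
    nth_rewrite 1 [hA]
    rw [Matrix.mul_add, Matrix.mul_add, h1, h2]
  have hHsplit : misfitHessian A = (Qᵀ * A)ᵀ * (Qᵀ * A) + Cᵀ * C := by
    have h3 : Cᵀ * Q = 0 := by
      rw [← Matrix.transpose_transpose (Cᵀ * Q), Matrix.transpose_mul, Matrix.transpose_transpose,
        hQC, Matrix.transpose_zero]
    have h4 : ∀ B : Matrix (Fin k) (Fin n) ℝ, (Q * B + C)ᵀ * (Q * B + C) = Bᵀ * B + Cᵀ * C := by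
      intro B
      rw [Matrix.transpose_add, Matrix.transpose_mul, Matrix.add_mul, Matrix.mul_add,
        Matrix.mul_add, Matrix.mul_assoc Bᵀ, Matrix.mul_assoc Bᵀ, ← Matrix.mul_assoc Qᵀ, hQ, hQC,
        ← Matrix.mul_assoc Cᵀ, h3]
      simp
    rw [← h4, ← hA, misfitHessian]
  have hDF : frobSq (Cᵀ * Ps * rightInv (Qᵀ * Ps)) = frobSq D := (frobSq_transpose _).symm
  rw [hDF] at hCD ⊢
  rw [hcore, hHsplit]
  refine opNorm_gram_add_sub_gram_le (Qᵀ * A) D C (misfitEig_nonneg A 0) (fun x => ?_) hCD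
  rw [← hHsplit]
  exact dotProduct_misfitHessian_mulVec_le A x

end Sketch

/-! Expected error of the sketch -/

section Expectation

open scoped Matrix.Norms.L2Operator

variable {m n : ℕ}

theorem lintegral_ofReal_affine_le {α : Type*} [MeasurableSpace α] {μ : Measure α}
    [IsProbabilityMeasure μ] {f : α → ℝ} (hf : ∀ x, 0 ≤ f x) {a b K : ℝ} (ha : 0 ≤ a) (hb : 0 ≤ b)
    (hK : 0 ≤ K) (h : ∫⁻ x, ENNReal.ofReal (f x) ∂μ ≤ ENNReal.ofReal K) :
    ∫⁻ x, ENNReal.ofReal (a + b * f x) ∂μ ≤ ENNReal.ofReal (a + b * K) := by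
  have h1 : ∀ x, ENNReal.ofReal (a + b * f x) =
      ENNReal.ofReal a + ENNReal.ofReal b * ENNReal.ofReal (f x) := fun x => by
    rw [ENNReal.ofReal_add ha (mul_nonneg hb (hf x)), ENNReal.ofReal_mul hb]
  rw [lintegral_congr h1, lintegral_add_left measurable_const, lintegral_const, measure_univ,
    mul_one, lintegral_const_mul' _ _ ENNReal.ofReal_ne_top, ENNReal.ofReal_add ha (by positivity),
    ENNReal.ofReal_mul hb]
  gcongr

/-- Serves the degenerate cases in which the residual or the eigenvalue tail vanishes and a quotient
by its square root has the default value 0. -/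
theorem ae_eq_zero_of_lintegral_ofReal_le {α : Type*} [MeasurableSpace α] {μ : Measure α}
    {f : α → ℝ} (hf : ∀ x, 0 ≤ f x) (hm : Measurable f) {K : ℝ}
    (h : ∫⁻ x, ENNReal.ofReal (f x) ∂μ ≤ ENNReal.ofReal K) :
    ∀ᵐ x ∂μ, K = 0 → f x = 0 := by
  by_cases hK : K = 0
  · rw [hK, ENNReal.ofReal_zero, nonpos_iff_eq_zero, lintegral_eq_zero_iff hm.ennreal_ofReal] at h
    filter_upwards [h] with x hx _
    exact le_antisymm (ENNReal.ofReal_eq_zero.1 hx) (hf x)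
  · exact ae_of_all _ fun x h => absurd h hK

theorem measurable_entry {ι κ : Type*} [Fintype ι] [Fintype κ] :
    EntryMeasurable fun X : ι → κ → ℝ => Matrix.of X :=
  EntryMeasurable.of_measurable measurable_id

/-- The average over `Ψ` with the range basis frozen: replacing `‖D‖_F²` by its mean bound `F²` in
`Λ(F + ‖D‖_F²/F) + ‖D‖_F²` yields `2ΛF + F²`. -/
theorem lintegral_norm_sketch_sub_le {l k : ℕ} (A : Matrix (Fin m) (Fin n) ℝ)
    (Q : Matrix (Fin m) (Fin k) ℝ) (hQ : Qᵀ * Q = 1) (hl : 2 * k + 1 ≤ l) :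
    (∀ᵐ Y ∂(gaussMat (Fin m) (Fin l)),
      IsUnit ((Qᵀ * Matrix.of Y) * (Qᵀ * Matrix.of Y)ᵀ).det) ∧
    ∫⁻ Y, ENNReal.ofReal ‖(sketchCore A (Matrix.of Y) Q)ᵀ * sketchCore A (Matrix.of Y) Q -
      misfitHessian A‖ ∂(gaussMat (Fin m) (Fin l)) ≤
      ENNReal.ofReal (2 * Real.sqrt (misfitEig A 0) * Real.sqrt (frobSq (A - Q * Qᵀ * A)) +
        frobSq (A - Q * Qᵀ * A)) := by
  set C := A - Q * Qᵀ * A with hC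
  set F := Real.sqrt (frobSq C) with hF
  set Λ := Real.sqrt (misfitEig A 0) with hΛ
  have hFF : F * F = frobSq C := Real.mul_self_sqrt (frobSq_nonneg C)
  have hCQ : Cᵀ * Q = 0 := by
    rw [hC, Matrix.transpose_sub, Matrix.sub_mul, Matrix.transpose_mul, Matrix.transpose_mul,
      Matrix.transpose_transpose, Matrix.mul_assoc Aᵀ, Matrix.mul_assoc Q, hQ, Matrix.mul_one,
      sub_self]
  obtain ⟨hdet, hint⟩ := gaussian_oblique_projection (κ := Fin l) Q hQ (by simpa using hl) Cᵀ hCQ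
  rw [frobSq_transpose] at hint
  set f : (Fin m → Fin l → ℝ) → ℝ :=
    fun Y => frobSq (Cᵀ * Matrix.of Y * rightInv (Qᵀ * Matrix.of Y)) with hf
  have hfm : Measurable f :=
    (((EntryMeasurable.const Cᵀ).mul measurable_entry).mul
      ((EntryMeasurable.const Qᵀ).mul measurable_entry).rightInv).frobSq
  have hf0 : ∀ Y, 0 ≤ f Y := fun Y => frobSq_nonneg _
  refine ⟨hdet, ?_⟩
  have hzero := ae_eq_zero_of_lintegral_ofReal_le hf0 hfm hint
  have hbound := lintegral_ofReal_affine_le hf0 (a := Λ * F) (b := Λ / F + 1) (by positivity)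
    (by positivity) (frobSq_nonneg C) hint
  refine le_trans (lintegral_mono_ae ?_) (hbound.trans (le_of_eq ?_))
  · filter_upwards [hdet, hzero] with Y hY hY0
    refine ENNReal.ofReal_le_ofReal ((norm_sketch_sub_le A (Matrix.of Y) Q hQ hY hY0).trans
      (le_of_eq ?_))
    change Λ * (F + f Y / F) + f Y = _
    ring
  · congr 1
    rcases (Real.sqrt_nonneg (frobSq C)).eq_or_lt with h0 | h0
    · have : F = 0 := h0.symm
      rw [← hFF, this]; simp
    · have : F ≠ 0 := h0.ne'
      rw [← hFF]
      field_simp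
      ring

theorem theta_eq (A : Matrix (Fin m) (Fin n) ℝ) (r : ℕ) :
    theta A r = 3 * (Real.sqrt (misfitEig A 0) *
      Real.sqrt (∑ j ∈ Finset.Ico r n, misfitEig A j)) +
        9 / 4 * ∑ j ∈ Finset.Ico r n, misfitEig A j := by
  rw [theta, ← Finset.mul_sum, Real.sqrt_mul (misfitEig_nonneg A 0)]

/-- The integrand is dominated by a measurable affine function of `f`, so `Q` and `R` may be
arbitrary functions here. -/
theorem lintegral_rangeFinder_le {r k : ℕ} (hr : r ≤ n) (A : Matrix (Fin m) (Fin n) ℝ)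
    (Q : (Fin n → Fin (2 * r + 1) → ℝ) → Matrix (Fin m) (Fin k) ℝ)
    (R : (Fin n → Fin (2 * r + 1) → ℝ) → Matrix (Fin k) (Fin (2 * r + 1)) ℝ)
    (hQ : ∀ X, (Q X)ᵀ * Q X = 1) (hQR : ∀ X, A * Matrix.of X = Q X * R X) :
    ∫⁻ X, ENNReal.ofReal (2 * Real.sqrt (misfitEig A 0) *
        Real.sqrt (frobSq (A - Q X * (Q X)ᵀ * A)) + frobSq (A - Q X * (Q X)ᵀ * A))
      ∂(gaussMat (Fin n) (Fin (2 * r + 1))) ≤ ENNReal.ofReal (theta A r) := by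
  obtain ⟨V, hV, hτ⟩ := exists_frobSq_tail A hr
  set E := A - A * V * Vᵀ with hE
  set τ := ∑ j ∈ Finset.Ico r n, misfitEig A j with hτdef
  set Λ := Real.sqrt (misfitEig A 0) with hΛ
  have hτ0 : 0 ≤ τ := hτ ▸ frobSq_nonneg E
  have hEV : E * V = 0 := by
    rw [hE, Matrix.sub_mul, Matrix.mul_assoc (A * V), hV, Matrix.mul_one, sub_self]
  obtain ⟨hdet, hint⟩ := gaussian_oblique_projection (κ := Fin (2 * r + 1)) V hV (by simp) E hEV
  rw [hτ] at hint
  set f : (Fin n → Fin (2 * r + 1) → ℝ) → ℝ :=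
    fun X => frobSq (E * Matrix.of X * rightInv (Vᵀ * Matrix.of X)) with hf
  have hfm : Measurable f :=
    (((EntryMeasurable.const E).mul measurable_entry).mul
      ((EntryMeasurable.const Vᵀ).mul measurable_entry).rightInv).frobSq
  have hf0 : ∀ X, 0 ≤ f X := fun X => frobSq_nonneg _
  have hzero := ae_eq_zero_of_lintegral_ofReal_le hf0 hfm hint
  -- The mean of `τ + f` is at most `2τ`. The square root is replaced by its tangent there, `2√c ≤ s
  -- + c/s`, which plays the role of Jensen's inequality.
  set s := Real.sqrt (2 * τ) with hs
  have hss : s * s = 2 * τ := Real.mul_self_sqrt (by positivity)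
  have hs0 : 0 ≤ s := Real.sqrt_nonneg _
  have hΛ0 : 0 ≤ Λ := Real.sqrt_nonneg _
  have hbound := lintegral_ofReal_affine_le hf0 (a := Λ * s + (Λ / s + 1) * τ)
    (b := Λ / s + 1) (by positivity) (by positivity) hτ0 hint
  refine le_trans (lintegral_mono_ae ?_) (hbound.trans (ENNReal.ofReal_le_ofReal ?_))
  · filter_upwards [hdet, hzero] with X hX hX0
    refine ENNReal.ofReal_le_ofReal ?_
    have hc := frobSq_rangeFinder_le A (Matrix.of X) (Q X) (R X) (hQ X) (hQR X) V hV hX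
    rw [← hE, hτ] at hc
    change _ ≤ τ + f X at hc
    set c := frobSq (A - Q X * (Q X)ᵀ * A)
    have hc0 : 0 ≤ c := frobSq_nonneg _
    set q := Real.sqrt c
    have hqq : q * q = c := Real.mul_self_sqrt hc0
    have h2q : 2 * q ≤ s + (τ + f X) / s := by
      rcases hs0.eq_or_lt with h0 | h0
      · have ht : τ = 0 := by rw [← h0] at hss; linarith
        have hq : q = 0 := by
          have : c = 0 := le_antisymm (by rw [ht, hX0 ht] at hc; linarith) hc0
          rw [this] at hqq
          exact mul_self_eq_zero.1 hqq
        rw [hq, ← h0]; simp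
      · have h1 : s + (τ + f X) / s - 2 * q = ((s - q) ^ 2 + (τ + f X - c)) / s := by
          rw [← hqq]; field_simp; ring
        have h2 : 0 ≤ ((s - q) ^ 2 + (τ + f X - c)) / s :=
          div_nonneg (by nlinarith [sq_nonneg (s - q)]) hs0
        linarith
    have h3 := mul_le_mul_of_nonneg_left h2q hΛ0
    have h4 : Λ * s + (Λ / s + 1) * τ + (Λ / s + 1) * f X =
        Λ * (s + (τ + f X) / s) + (τ + f X) := by ring
    rw [h4]
    linarith
  · have h5 : Λ * s + (Λ / s + 1) * τ + (Λ / s + 1) * τ = 2 * (Λ * s) + s * s := by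
      rcases hs0.eq_or_lt with h0 | h0
      · have ht : τ = 0 := by rw [← h0] at hss; linarith
        rw [ht, ← h0]; simp
      · have ht : τ = s * s / 2 := by linarith
        rw [ht]
        field_simp
        ring
    -- From `√2 ≤ 3/2`: this turns `2√2` into the constant 3, and `2 ≤ (3/2)² = 9/4` gives the
    -- other.
    have h6 : s ≤ 3 / 2 * Real.sqrt τ := by
      rw [hs]
      refine Real.sqrt_le_iff.2 ⟨by positivity, ?_⟩
      rw [mul_pow, Real.sq_sqrt hτ0]
      linarith
    rw [h5, theta_eq, hss]
    have := mul_le_mul_of_nonneg_left h6 hΛ0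
    change 2 * (Λ * s) + 2 * τ ≤ 3 * (Λ * Real.sqrt τ) + 9 / 4 * τ
    linarith

end Expectation

/-! ### Joint law of the two test matrices -/

section Law

variable {S : Type*} [MeasurableSpace S] {P : Measure S}

theorem IsStdGaussianPair.hasLaw [IsProbabilityMeasure P] {a b c d : ℕ}
    {Om : S → Matrix (Fin a) (Fin b) ℝ}
    {Ps : S → Matrix (Fin c) (Fin d) ℝ} (h : IsStdGaussianPair P Om Ps) :
    HasLaw (fun w => ((fun i j => Om w i j, fun i j => Ps w i j) :
      (Fin a → Fin b → ℝ) × (Fin c → Fin d → ℝ)))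
      ((gaussMat (Fin a) (Fin b)).prod (gaussMat (Fin c) (Fin d))) P := by
  obtain ⟨h1, h2, h3⟩ := h
  have hlaw := h3.hasLaw_pi (μ := fun _ => gaussianReal 0 1) (by
    rintro (e | e)
    · exact h1 e.1 e.2
    · exact h2 e.1 e.2)
  have hcurry : ∀ p q : ℕ, MeasurePreserving (MeasurableEquiv.curry (Fin p) (Fin q) ℝ)
      (gaussVec (Fin p × Fin q)) (gaussMat (Fin p) (Fin q)) := by
    intro p q
    have : MeasurePreserving (MeasurableEquiv.curry (Fin p) (Fin q) ℝ).symm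
      (gaussMat (Fin p) (Fin q)) (gaussVec (Fin p × Fin q)) := measurePreserving_uncurry _ _
    exact this.symm
  have hmp := ((hcurry a b).prod (hcurry c d)).comp
    (measurePreserving_sumPiEquivProdPi
      (X := fun _ : Fin a × Fin b ⊕ Fin c × Fin d => ℝ) (fun _ => gaussianReal 0 1))
  exact hmp.comp_hasLaw hlaw

end Law

/-! ### The approximate Hessian as a measurable function of the test matrices, and the main theorem
-/

section Main

open scoped Matrix.Norms.L2Operator

variable {m n : ℕ}

/-- The approximate Hessian as a function of the Gaussian test matrices. -/
def sketchHessian {l₁ l₂ : ℕ} (A : Matrix (Fin m) (Fin n) ℝ)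
    (qr : Matrix (Fin m) (Fin l₁) ℝ →
      Matrix (Fin m) (Fin (min m l₁)) ℝ × Matrix (Fin (min m l₁)) (Fin l₁) ℝ)
    (z : (Fin n → Fin l₁ → ℝ) × (Fin m → Fin l₂ → ℝ)) : Matrix (Fin n) (Fin n) ℝ :=
  (sketchCore A (Matrix.of z.2) (qr (A * Matrix.of z.1)).1)ᵀ *
    sketchCore A (Matrix.of z.2) (qr (A * Matrix.of z.1)).1

theorem sketchHessian_posSemidef {l₁ l₂ : ℕ} (A : Matrix (Fin m) (Fin n) ℝ)
    (qr : Matrix (Fin m) (Fin l₁) ℝ →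
      Matrix (Fin m) (Fin (min m l₁)) ℝ × Matrix (Fin (min m l₁)) (Fin l₁) ℝ)
    (z : (Fin n → Fin l₁ → ℝ) × (Fin m → Fin l₂ → ℝ)) : (sketchHessian A qr z).PosSemidef := by
  simpa [sketchHessian] using Matrix.posSemidef_conjTranspose_mul_self
    (sketchCore A (Matrix.of z.2) (qr (A * Matrix.of z.1)).1)

theorem entryMeasurable_rangeBasis {l₁ l₂ : ℕ} (A : Matrix (Fin m) (Fin n) ℝ)
    {qr : Matrix (Fin m) (Fin l₁) ℝ →
      Matrix (Fin m) (Fin (min m l₁)) ℝ × Matrix (Fin (min m l₁)) (Fin l₁) ℝ}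
    (hqr : IsThinQRRoutine qr) :
    EntryMeasurable fun z : (Fin n → Fin l₁ → ℝ) × (Fin m → Fin l₂ → ℝ) =>
      (qr (A * Matrix.of z.1)).1 := fun i j =>
  (hqr.2 i j).comp (measurable_pi_lambda _ fun a => measurable_pi_lambda _ fun b =>
    ((EntryMeasurable.const A).mul (EntryMeasurable.of_measurable measurable_fst)) a b)

theorem entryMeasurable_sketchHessian {l₁ l₂ : ℕ} (A : Matrix (Fin m) (Fin n) ℝ)
    {qr : Matrix (Fin m) (Fin l₁) ℝ →
      Matrix (Fin m) (Fin (min m l₁)) ℝ × Matrix (Fin (min m l₁)) (Fin l₁) ℝ}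
    (hqr : IsThinQRRoutine qr) :
    EntryMeasurable (sketchHessian (l₂ := l₂) A qr) := by
  have hQ := entryMeasurable_rangeBasis (l₂ := l₂) A hqr
  have hY : EntryMeasurable fun z : (Fin n → Fin l₁ → ℝ) × (Fin m → Fin l₂ → ℝ) =>
      Matrix.of z.2 := EntryMeasurable.of_measurable measurable_snd
  have hM := hQ.transpose.mul hY
  have hcore : EntryMeasurable fun z : (Fin n → Fin l₁ → ℝ) × (Fin m → Fin l₂ → ℝ) =>
      sketchCore A (Matrix.of z.2) (qr (A * Matrix.of z.1)).1 :=
    ((hM.mul hM.transpose).inv.mul hM).mul (hY.transpose.mul (EntryMeasurable.const A))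
  exact hcore.transpose.mul hcore

theorem theta_eq_intrinsicDim (A : Matrix (Fin m) (Fin n) ℝ) (r : ℕ) (h : misfitEig A r ≠ 0) :
    theta A r = (3 * Real.sqrt (misfitEig A 0 / misfitEig A r) * Real.sqrt (intrinsicDim A r) +
      9 / 4 * intrinsicDim A r) * misfitEig A r := by
  have hpos : 0 < misfitEig A r := lt_of_le_of_ne (misfitEig_nonneg A r) (Ne.symm h)
  have hs := Real.mul_self_sqrt hpos.le
  have hne : Real.sqrt (misfitEig A r) ≠ 0 := (Real.sqrt_pos.2 hpos).ne'
  rw [theta_eq, intrinsicDim, Real.sqrt_div (misfitEig_nonneg A 0),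
    Real.sqrt_div (Finset.sum_nonneg fun j _ => misfitEig_nonneg A j)]
  set q := Real.sqrt (misfitEig A r)
  rw [← hs]
  field_simp

theorem theta_nonneg (A : Matrix (Fin m) (Fin n) ℝ) (r : ℕ) : 0 ≤ theta A r := by
  have : 0 ≤ ∑ j ∈ Finset.Ico r n, misfitEig A j :=
    Finset.sum_nonneg fun j _ => misfitEig_nonneg A j
  rw [theta_eq]
  positivity

end Main

end GNSketch

end

theorem theorem3 {S : Type*} [MeasurableSpace S] (P : Measure S) [IsProbabilityMeasure P]
    (m n r : ℕ) (hmn : m ≤ n) (hr : r ≤ m)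
    (A : Matrix (Fin m) (Fin n) ℝ)
    (Γ : Matrix (Fin n) (Fin n) ℝ) (hΓ : Γ.PosDef)
    (qr : Matrix (Fin m) (Fin (2 * r + 1)) ℝ →
      Matrix (Fin m) (Fin (min m (2 * r + 1))) ℝ ×
        Matrix (Fin (min m (2 * r + 1))) (Fin (2 * r + 1)) ℝ)
    (hqr : GNSketch.IsThinQRRoutine qr)
    (Om : S → Matrix (Fin n) (Fin (2 * r + 1)) ℝ)
    (Ps : S → Matrix (Fin m) (Fin (4 * r + 3)) ℝ)
    (hgauss : GNSketch.IsStdGaussianPair P Om Ps)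
    (V : S → Matrix (Fin n) (Fin (min (min m (2 * r + 1)) n)) ℝ)
    (L : S → Matrix (Fin (min (min m (2 * r + 1)) n)) (Fin (min (min m (2 * r + 1)) n)) ℝ)
    (hout : ∀ w, GNSketch.IsSingleViewOutput A qr (Om w) (Ps w) (V w) (L w))
    (H : Matrix (Fin n) (Fin n) ℝ) (hH : H = GNSketch.misfitHessian A)
    (Hhat : S → Matrix (Fin n) (Fin n) ℝ) (hHhat : ∀ w, Hhat w = V w * L w * (V w)ᵀ) :
    (∀ g : Fin n → ℝ, g ≠ 0 →
      Integrable (fun w => GNSketch.relStepError Γ H (Hhat w) g) P ∧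
      ∫ w, GNSketch.relStepError Γ H (Hhat w) g ∂P ≤ GNSketch.theta A r) ∧
    (Integrable (fun w => Real.sqrt (GNSketch.cond2 (GNSketch.precond H (Hhat w)))) P ∧
      ∫ w, Real.sqrt (GNSketch.cond2 (GNSketch.precond H (Hhat w))) ∂P
        ≤ 1 + GNSketch.theta A r) ∧
    (GNSketch.misfitEig A r ≠ 0 →
      GNSketch.theta A r =
        (3 * Real.sqrt (GNSketch.misfitEig A 0 / GNSketch.misfitEig A r) *
            Real.sqrt (GNSketch.intrinsicDim A r) +
          9 / 4 * GNSketch.intrinsicDim A r) * GNSketch.misfitEig A r) := by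
  subst hH
  open scoped Matrix.Norms.L2Operator in
  have hHpsd := GNSketch.misfitHessian_posSemidef A
  -- The basis `Q_Y` has at most `2r + 1` columns, so `Ψ` oversamples it as required.
  have hk : 2 * min m (2 * r + 1) + 1 ≤ 4 * r + 3 := by omega
  set J := fun w => ((fun i j => Om w i j, fun i j => Ps w i j) :
    (Fin n → Fin (2 * r + 1) → ℝ) × (Fin m → Fin (4 * r + 3) → ℝ))
  have hJ : HasLaw J _ P := hgauss.hasLaw
  set Φ := GNSketch.sketchHessian (l₂ := 4 * r + 3) A qr with hΦ
  have hΦm : GNSketch.EntryMeasurable Φ := GNSketch.entryMeasurable_sketchHessian A hqr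
  have hΦpsd : ∀ z, (Φ z).PosSemidef := GNSketch.sketchHessian_posSemidef A qr
  have hQ : ∀ X : Fin n → Fin (2 * r + 1) → ℝ,
      (qr (A * Matrix.of X)).1ᵀ * (qr (A * Matrix.of X)).1 = 1 := fun X => (hqr.1 _).2.1
  have hinner := fun X : Fin n → Fin (2 * r + 1) → ℝ =>
    GNSketch.lintegral_norm_sketch_sub_le A (qr (A * Matrix.of X)).1 (hQ X) hk
  -- `V` and `L` may depend non-measurably on `w`; `Hhat` still agrees almost surely with a
  -- measurable function of the test matrices.
  have hEq : ∀ᵐ w ∂P, Hhat w = Φ (J w) := by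
    have hQm := GNSketch.entryMeasurable_rangeBasis (l₂ := 4 * r + 3) A hqr
    have hMm := hQm.transpose.mul (GNSketch.EntryMeasurable.of_measurable measurable_snd)
    have hdet : ∀ᵐ z ∂((GNSketch.gaussMat (Fin n) (Fin (2 * r + 1))).prod
        (GNSketch.gaussMat (Fin m) (Fin (4 * r + 3)))),
        (((qr (A * Matrix.of z.1)).1ᵀ * Matrix.of z.2) *
          ((qr (A * Matrix.of z.1)).1ᵀ * Matrix.of z.2)ᵀ).det ≠ 0 := by
      refine (Measure.ae_prod_iff_ae_ae
        ((hMm.mul hMm.transpose).det (measurableSet_singleton (0 : ℝ)).compl)).2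
        (ae_of_all _ fun X => ?_)
      filter_upwards [(hinner X).1] with Y hY
      exact hY.ne_zero
    have hdetP := ae_of_ae_map hJ.aemeasurable (by rw [hJ.map_eq]; exact hdet)
    filter_upwards [hdetP] with w hw
    rw [hHhat]
    exact GNSketch.singleViewOutput_eq A qr (Om w) (Ps w) (V w) (L w) (hout w) hw.isUnit
  have hnorm : Measurable fun z => ‖Φ z - GNSketch.misfitHessian A‖ :=
    (hΦm.sub (GNSketch.EntryMeasurable.const _)).norm
  have hlint : ∫⁻ w, ENNReal.ofReal ‖Φ (J w) - GNSketch.misfitHessian A‖ ∂P ≤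
      ENNReal.ofReal (GNSketch.theta A r) := by
    rw [hJ.lintegral_comp (f := fun z => ENNReal.ofReal ‖Φ z - GNSketch.misfitHessian A‖)
      hnorm.ennreal_ofReal.aemeasurable]
    -- Independence: `Ψ` is averaged out for fixed `Ω`, then `Ω`.
    refine (lintegral_prod_le _).trans ((lintegral_mono fun X => (hinner X).2).trans ?_)
    exact GNSketch.lintegral_rangeFinder_le (hr.trans hmn) A (fun X => (qr (A * Matrix.of X)).1)
      (fun X => (qr (A * Matrix.of X)).2) hQ fun X => (hqr.1 _).1
  have hδm : AEStronglyMeasurable (fun w => ‖Φ (J w) - GNSketch.misfitHessian A‖) P :=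
    (hnorm.comp_aemeasurable hJ.aemeasurable).aestronglyMeasurable
  have hδ0 : 0 ≤ᵐ[P] fun w => ‖Φ (J w) - GNSketch.misfitHessian A‖ :=
    ae_of_all _ fun _ => norm_nonneg _
  have hδ : Integrable (fun w => ‖Φ (J w) - GNSketch.misfitHessian A‖) P :=
    (lintegral_ofReal_ne_top_iff_integrable hδm hδ0).1
      (hlint.trans_lt ENNReal.ofReal_lt_top).ne
  have hδint : ∫ w, ‖Φ (J w) - GNSketch.misfitHessian A‖ ∂P ≤ GNSketch.theta A r := by
    rw [integral_eq_lintegral_of_nonneg_ae hδ0 hδm]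
    exact ENNReal.toReal_le_of_le_ofReal (GNSketch.theta_nonneg A r) hlint
  refine ⟨fun g _ => ?_, ?_, GNSketch.theta_eq_intrinsicDim A r⟩
  · have hm : AEStronglyMeasurable
        (fun w => GNSketch.relStepError Γ (GNSketch.misfitHessian A) (Hhat w) g) P := by
      refine AEStronglyMeasurable.congr (((hΦm.relStepError
        (H := GNSketch.misfitHessian A) hΓ g).comp_aemeasurable
        hJ.aemeasurable).aestronglyMeasurable) ?_
      filter_upwards [hEq] with w hw
      rw [hw]
      rfl
    have hle : ∀ᵐ w ∂P, GNSketch.relStepError Γ (GNSketch.misfitHessian A) (Hhat w) g ≤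
        ‖Φ (J w) - GNSketch.misfitHessian A‖ := by
      filter_upwards [hEq] with w hw
      rw [hw]
      exact GNSketch.relStepError_le hΓ hHpsd (hΦpsd _) g
    have hint : Integrable
        (fun w => GNSketch.relStepError Γ (GNSketch.misfitHessian A) (Hhat w) g) P := by
      refine hδ.mono' hm ?_
      filter_upwards [hle] with w hw
      rwa [Real.norm_eq_abs, abs_of_nonneg (GNSketch.relStepError_nonneg _ _ _ _)]
    exact ⟨hint, (integral_mono_ae hint hδ hle).trans hδint⟩
  · have hm : AEStronglyMeasurable (fun w => Real.sqrt (GNSketch.cond2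
        (GNSketch.precond (GNSketch.misfitHessian A) (Hhat w)))) P := by
      refine AEStronglyMeasurable.congr (((hΦm.sqrt_cond2_precond hHpsd hΦpsd).comp_aemeasurable
        hJ.aemeasurable).aestronglyMeasurable) ?_
      filter_upwards [hEq] with w hw
      rw [hw]
      rfl
    have hle : ∀ᵐ w ∂P, Real.sqrt (GNSketch.cond2
        (GNSketch.precond (GNSketch.misfitHessian A) (Hhat w))) ≤
        1 + ‖Φ (J w) - GNSketch.misfitHessian A‖ := by
      filter_upwards [hEq] with w hw
      rw [hw]
      exact GNSketch.sqrt_cond2_precond_le hHpsd (hΦpsd _)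
    have h1δ := (integrable_const (1 : ℝ)).add hδ
    have hint : Integrable (fun w => Real.sqrt (GNSketch.cond2
        (GNSketch.precond (GNSketch.misfitHessian A) (Hhat w)))) P := by
      refine h1δ.mono' hm ?_
      filter_upwards [hle] with w hw
      rwa [Real.norm_eq_abs, abs_of_nonneg (Real.sqrt_nonneg _)]
    refine ⟨hint, (integral_mono_ae hint h1δ hle).trans ?_⟩
    have hsum : ∫ w, (1 + ‖Φ (J w) - GNSketch.misfitHessian A‖) ∂P =
        1 + ∫ w, ‖Φ (J w) - GNSketch.misfitHessian A‖ ∂P := by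
      rw [integral_add (integrable_const _) hδ]
      simp
    exact hsum.le.trans (by linarith)
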